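/- Let $\mathbb T=\mathbb R/2\pi\mathbb Z$. For a real-valued distribution $u$ on $\mathbb T$ let $\widehat u(k)=\frac1{2\pi}\int_0^{2\pi}u(x)e^{-ikx}\,dx$ ($k\in\mathbb Z$) be its Fourier coefficients, let $P_0u=\frac1{2\pi}\int_0^{2\pi}u\,dx$ be its mean, regarded as a constant function, and for $s\in\mathbb R$ let $$\|u\|_{H^s}=(2\pi)^{1/2}\Big(\sum_{k\in\mathbb Z}(1+k^2)^{s}|\widehat u(k)|^2\Big)^{1/2}.$$ Let $H^s_0(\mathbb T)$ be the space of real-valued distributions $u$ on $\mathbb T$ with $\|u\|_{H^s}<\infty$ and $P_0u=0$, with this norm. Let $s\ge 1/2$, and let $M v := v_x+v^2-P_0(v^2)$ for $v\in H^s_0(\mathbb T)$, where $v_x$ is the distributional derivative and $v^2$ is the pointwise square of the function $v\in L^2(\mathbb T)$. Then $M$ is a bijection from $H^s_0(\mathbb T)$ onto $H^{s-1}_0(\mathbb T)$, and the inverse map $M^{-1}$ is locally Lipschitz from $H^{s-1}_0(\mathbb T)$ to $H^s_0(\mathbb T)$, in the sense that it is Lipschitz on every ball of $H^{s-1}_0(\mathbb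 T)$, with a Lipschitz constant that may depend on $s$ and on the ball. -/

import Mathlib

/-!
Real periodic distributions on the circle `𝕋 = ℝ / 2πℤ`, the mean-zero Sobolev spaces `H^s_0(𝕋)`,
and the Miura map `M v = v_x + v² - P₀(v²)`.
-/

namespace Miura

noncomputable section

open MeasureTheory
open scoped ContDiff

/-- Test functions on `𝕋`: smooth real functions on `ℝ` that are `2π`-periodic. -/
def TestFunction : Submodule ℝ (ℝ → ℝ) where
  carrier := {φ | ContDiff ℝ ∞ φ ∧ Function.Periodic φ (2 * Real.pi)}
  add_mem' hφ hψ := ⟨hφ.1.add hψ.1, hφ.2.add hψ.2⟩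
  zero_mem' := ⟨contDiff_const, fun _ => rfl⟩
  smul_mem' c φ hφ := ⟨contDiff_const.smul hφ.1, fun x => by simp [hφ.2 x]⟩

/-- The derivative as a linear map on test functions. -/
def TestFunction.deriv : TestFunction →ₗ[ℝ] TestFunction where
  toFun φ := ⟨_root_.deriv φ.1, (contDiff_infty_iff_deriv.1 φ.2.1).2, fun x => by
    rw [← deriv_comp_add_const]
    exact congrArg (fun f => _root_.deriv f x) (funext φ.2.2)⟩
  map_add' φ ψ := by
    ext x
    exact deriv_add (φ.2.1.differentiable (by simp) x) (ψ.2.1.differentiable (by simp) x)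
  map_smul' c φ := by
    ext x
    exact deriv_const_smul c (φ.2.1.differentiable (by simp) x)

/-- The test function `x ↦ cos (k x)`. -/
def TestFunction.cos (k : ℤ) : TestFunction :=
  ⟨fun x => Real.cos (k * x), by fun_prop, fun x => by
    show Real.cos (k * (x + 2 * Real.pi)) = Real.cos (k * x)
    rw [mul_add]; exact Real.cos_add_int_mul_two_pi _ k⟩

/-- The test function `x ↦ sin (k x)`. -/
def TestFunction.sin (k : ℤ) : TestFunction :=
  ⟨fun x => Real.sin (k * x), by fun_prop, fun x => by
    show Real.sin (k * (x + 2 * Real.pi)) = Real.sin (k * x)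
    rw [mul_add]; exact Real.sin_add_int_mul_two_pi _ k⟩

/-- Real distributions on `𝕋`: linear functionals on the test functions that are continuous, that is,
bounded by a constant times `max_{j ≤ N} sup_x |φ^{(j)}(x)|` for some `N`. -/
def Distribution : Submodule ℝ (TestFunction →ₗ[ℝ] ℝ) where
  carrier := {u | ∃ (N : ℕ) (C : ℝ), ∀ (φ : TestFunction) (B : ℝ),
    (∀ j ≤ N, ∀ x, |iteratedDeriv j φ.1 x| ≤ B) → |u φ| ≤ C * B}
  add_mem' := by
    rintro u v ⟨N, C, hu⟩ ⟨N', C', hv⟩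
    refine ⟨max N N', C + C', fun φ B h => ?_⟩
    have h1 := hu φ B fun j hj => h j (hj.trans (le_max_left _ _))
    have h2 := hv φ B fun j hj => h j (hj.trans (le_max_right _ _))
    have h3 := abs_add_le (u φ) (v φ)
    rw [LinearMap.add_apply, add_mul]
    linarith
  zero_mem' := ⟨0, 0, fun φ B _ => by simp⟩
  smul_mem' := by
    rintro c u ⟨N, C, hu⟩
    refine ⟨N, |c| * C, fun φ B h => ?_⟩
    rw [LinearMap.smul_apply, smul_eq_mul, abs_mul, mul_assoc]
    exact mul_le_mul_of_nonneg_left (hu φ B h) (abs_nonneg c)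

/-- The distributional derivative `⟨u_x, φ⟩ = -⟨u, φ_x⟩`. -/
def dx (u : Distribution) : Distribution :=
  ⟨-(u.1 ∘ₗ TestFunction.deriv), by
    obtain ⟨N, C, hu⟩ := u.2
    refine ⟨N + 1, C, fun φ B h => ?_⟩
    rw [LinearMap.neg_apply, abs_neg]
    refine hu _ B fun j hj x => ?_
    have := h (j + 1) (by omega) x
    rwa [iteratedDeriv_succ'] at this⟩

/-- The distribution `φ ↦ ∫_0^{2π} f φ` given by an integrable function `f` on the period. -/
def ofFun (f : ℝ → ℝ) (hf : IntegrableOn f (Set.Ioc 0 (2 * Real.pi))) :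
    Distribution :=
  have key (φ : TestFunction) :
      IntegrableOn (fun x => f x * φ.1 x) (Set.Ioc 0 (2 * Real.pi)) :=
    hf.mul_continuousOn_of_subset φ.2.1.continuous.continuousOn measurableSet_Ioc isCompact_Icc
      Set.Ioc_subset_Icc_self
  ⟨{ toFun := fun φ => ∫ x in Set.Ioc 0 (2 * Real.pi), f x * φ.1 x
     map_add' := fun φ ψ => by
       rw [← integral_add (key φ) (key ψ)]
       exact integral_congr_ae (ae_of_all _ fun x => mul_add _ _ _)
     map_smul' := fun c φ => by
       rw [RingHom.id_apply, smul_eq_mul, ← integral_const_mul]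
       exact integral_congr_ae (ae_of_all _ fun x => mul_left_comm _ _ _) },
   0, ∫ x in Set.Ioc 0 (2 * Real.pi), |f x|, fun φ B h => by
     rw [← integral_mul_const]
     refine abs_integral_le_integral_abs.trans
       (integral_mono (key φ).abs (hf.abs.mul_const B) fun x => ?_)
     have := h 0 le_rfl x
     rw [iteratedDeriv_zero] at this
     show |f x * φ.1 x| ≤ |f x| * B
     rw [abs_mul]
     exact mul_le_mul_of_nonneg_left this (abs_nonneg _)⟩

/-- Fourier coefficients `û(k) = (1/2π) ⟨u, e^{-ikx}⟩`. -/
def fourierCoeff (u : Distribution) (k : ℤ) : ℂ :=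
  (1 / (2 * Real.pi) : ℂ) *
    ((u.1 (TestFunction.cos k) : ℂ) - Complex.I * (u.1 (TestFunction.sin k) : ℂ))

/-- The mean operator `P₀ u = (1/2π) ∫_0^{2π} u`, as a constant function on `𝕋`
(`TestFunction.cos 0` is the constant function `1`). -/
def P0 (u : Distribution) : Distribution :=
  ofFun (fun _ => 1 / (2 * Real.pi) * u.1 (TestFunction.cos 0))
    (integrableOn_const measure_Ioc_lt_top.ne)

/-- `f` is a square-integrable function on the period that represents the distribution `v`. -/
def IsL2Rep (v : Distribution) (f : ℝ → ℝ) : Prop :=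
  MemLp f 2 (volume.restrict (Set.Ioc 0 (2 * Real.pi))) ∧
    ∀ φ : TestFunction, v.1 φ = ∫ x in Set.Ioc 0 (2 * Real.pi), f x * φ.1 x

open Classical in
/-- The pointwise square `v²` of a distribution `v` that is an `L²` function (such a function is
unique up to a null set); by convention `0` for all other distributions. -/
def sq (v : Distribution) : Distribution :=
  if h : ∃ f, IsL2Rep v f then
    ofFun (fun x => h.choose x ^ 2) h.choose_spec.1.integrable_sq
  else 0

/-- The Sobolev norm `‖u‖_{H^s} = (2π)^{1/2} ‖⟨k⟩^s û(k)‖_{ℓ²}`, where `⟨k⟩ = (1 + k²)^{1/2}`. -/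
def sobolevNorm (s : ℝ) (u : Distribution) : ℝ :=
  Real.sqrt (2 * Real.pi) *
    Real.sqrt (∑' k : ℤ, (Real.sqrt (1 + (k : ℝ) ^ 2) ^ s * ‖fourierCoeff u k‖) ^ 2)

/-- The space `H^s_0(𝕋)` of real distributions of finite `H^s` norm and of mean zero. -/
def SobolevZero (s : ℝ) : Set Distribution :=
  {u | Summable (fun k : ℤ => (Real.sqrt (1 + (k : ℝ) ^ 2) ^ s * ‖fourierCoeff u k‖) ^ 2) ∧
    P0 u = 0}

/-- The Miura map `M v = v_x + v² - P₀(v²)`. -/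
def miura (v : Distribution) : Distribution :=
  dx v + sq v - P0 (sq v)

end

end Miura

/-! Applying the mean-zero primitive ∂⁻¹ turns M v = u into F(v) = v + B(v, v) = ∂⁻¹u, where B(v, w)
= ∂⁻¹(vw - P₀(vw)) is symmetric and bilinear. Since s ≥ 0, every v in question lies in L², so the
equation is solved there, on Fourier coefficients (`RealSeq`), and regularity is recovered
afterwards. The product of two L² functions has bounded coefficients, and division by ik then gains
a quarter of a derivative (`exists_weightedNorm_primitiveMul_le`); in particular B is bounded on L².

Everything rests on F(v) - F(w) = (v - w) + B(v + w, v - w) and two estimates in L². First, d + B(a,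
d) controls d, uniformly for a in a ball (`norm_le_linearized`): with e = B(a, d) and h = d + e, the
equation e' + ae = ah - c is solved by an integrating factor. Second, F(v) controls v
(`norm_le_quadratic`): testing w' = v² - m, w = B(v, v), against exp(2∫v) bounds m, the mean of v².
Both are proved by calculus for continuous functions and extended by density.

The estimates make F injective with inverse Lipschitz on balls. The range of F is open, because the
derivative 1 + B(2v, ·) is invertible by the method of continuity, and closed, because the inverse
is Lipschitz; so F is onto (`quadratic_surjective`).

In H^s, write v - w = (F(v) - F(w)) - B(v + w, v - w). A Lipschitz estimate for v - w at level σ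
improves to σ + 1/4, up to the level s of the data (`LipschitzInverse.gain`); finitely many steps
reach s. Since ∂ is an isomorphism from H^s_0 to H^{s-1}_0, the result passes from F to M. -/

namespace Miura
open Filter Topology

/-! ### Quadratic perturbations of the identity in a Banach space -/

section QuadraticMap

variable {E : Type*} [NormedAddCommGroup E] [NormedSpace ℝ E]

/-- A perturbation `1 + T` of the identity is invertible if all `1 + t T`, `t ∈ [0, 1]`, are bounded
below with the same constant. -/
theorem isUnit_one_add_of_bounded_below [CompleteSpace E] (T : E →L[ℝ] E) (C : ℝ)
    (h : ∀ t ∈ Set.Icc (0 : ℝ) 1, ∀ d, ‖d‖ ≤ C * ‖d + t • T d‖) : IsUnit (1 + T) := by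
  let P : ℝ → E →L[ℝ] E := fun t => 1 + t • T
  have hP : Continuous P := by fun_prop
  let Z : Set (Set.Icc (0 : ℝ) 1) := {t | IsUnit (P t)}
  have hopen : IsOpen Z :=
    Units.isOpen.preimage (hP.comp continuous_subtype_val)
  have hclosed : IsClosed Z := by
    refine isClosed_of_closure_subset fun t ht => ?_
    have hev : ∀ᶠ r : Set.Icc (0 : ℝ) 1 in 𝓝 t, ‖P t - P r‖ < (|C| + 1)⁻¹ := by
      have : Tendsto (fun r : Set.Icc (0 : ℝ) 1 => ‖P t - P r‖) (𝓝 t) (𝓝 ‖P t - P t‖) :=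
        (continuous_const.sub (hP.comp continuous_subtype_val)).norm.tendsto t
      rw [sub_self, norm_zero] at this
      exact this.eventually (gt_mem_nhds (by positivity))
    obtain ⟨r, hr, ⟨u, hu⟩⟩ := mem_closure_iff_nhds.1 ht _ hev
    -- The lower bound transfers to the inverse, so the radius of invertibility around points of `Z`
    -- is uniform. This is what makes `Z` closed.
    have hinv : ‖(↑u⁻¹ : E →L[ℝ] E)‖ ≤ |C| := by
      refine ContinuousLinearMap.opNorm_le_bound _ (abs_nonneg C) fun x => ?_
      have h1 := h r r.2 ((↑u⁻¹ : E →L[ℝ] E) x)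
      have h2 : (↑u⁻¹ : E →L[ℝ] E) x + (r : ℝ) • T ((↑u⁻¹ : E →L[ℝ] E) x) = x := by
        have : (u * ↑u⁻¹ : E →L[ℝ] E) x = x := by rw [Units.mul_inv]; rfl
        rw [hu] at this
        exact this
      rw [h2] at h1
      exact h1.trans (mul_le_mul_of_nonneg_right (le_abs_self C) (norm_nonneg x))
    rcases subsingleton_or_nontrivial E with hE | hE
    · exact ⟨1, Subsingleton.elim _ _⟩
    have hpos : 0 < ‖(↑u⁻¹ : E →L[ℝ] E)‖ := norm_pos_iff.2 u⁻¹.ne_zero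
    refine ⟨Units.ofNearby u (P t) ?_, rfl⟩
    rw [hu]
    refine hr.trans_le (inv_anti₀ hpos (by linarith))
  have huniv : Z = Set.univ :=
    IsClopen.eq_univ ⟨hclosed, hopen⟩ ⟨⟨0, by simp⟩, by simp [Z, P]⟩
  have h1 : (⟨1, by simp⟩ : Set.Icc (0 : ℝ) 1) ∈ Z := huniv ▸ Set.mem_univ _
  simpa [Z, P] using h1

variable (B : E →L[ℝ] E →L[ℝ] E)

theorem quadratic_sub (hB : ∀ a b, B a b = B b a) (v w : E) :
    (v + B v v) - (w + B w w) = (v - w) + B (v + w) (v - w) := by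
  simp only [map_add, map_sub, _root_.add_apply]
  rw [hB w v]; abel

/-- By `quadratic_sub` a difference of values is the linearized map at `v + w` applied to `v - w`,
and `v + w` stays in the ball of radius 2K given by the a priori bound. -/
theorem quadratic_lipschitz (hB : ∀ a b, B a b = B b a)
    (hlin : ∀ R : ℝ, ∃ C : ℝ, ∀ a d, ‖a‖ ≤ R → ‖d‖ ≤ C * ‖d + B a d‖)
    (hbdd : ∀ R : ℝ, ∃ K : ℝ, ∀ v, ‖v + B v v‖ ≤ R → ‖v‖ ≤ K) (R : ℝ) :
    ∃ L : ℝ, ∀ v w, ‖v + B v v‖ ≤ R → ‖w + B w w‖ ≤ R →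
      ‖v - w‖ ≤ L * ‖(v + B v v) - (w + B w w)‖ := by
  obtain ⟨K, hK⟩ := hbdd R
  obtain ⟨C, hC⟩ := hlin (K + K)
  refine ⟨C, fun v w hv hw => ?_⟩
  rw [quadratic_sub B hB]
  exact hC _ _ ((norm_add_le _ _).trans (add_le_add (hK v hv) (hK w hw)))

/-- The range is nonempty, open by the inverse function theorem, and closed because preimages of a
convergent sequence are Cauchy. Connectedness of the space finishes. -/
theorem quadratic_surjective [CompleteSpace E] (hB : ∀ a b, B a b = B b a)
    (hlin : ∀ R : ℝ, ∃ C : ℝ, ∀ a d, ‖a‖ ≤ R → ‖d‖ ≤ C * ‖d + B a d‖)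
    (hbdd : ∀ R : ℝ, ∃ K : ℝ, ∀ v, ‖v + B v v‖ ≤ R → ‖v‖ ≤ K) :
    Function.Surjective fun v => v + B v v := by
  let F : E → E := fun v => v + B v v
  have hcont : Continuous F := by fun_prop
  -- Since `t • B a = B (t • a)` with `‖t • a‖ ≤ ‖a‖`, one constant serves the whole segment from
  -- the identity.
  have hunit (a : E) : IsUnit (1 + B a) := by
    obtain ⟨C, hC⟩ := hlin ‖a‖
    refine isUnit_one_add_of_bounded_below _ C fun t ht d => ?_
    have := hC (t • a) d (by
      rw [norm_smul, Real.norm_of_nonneg ht.1]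
      exact mul_le_of_le_one_left (norm_nonneg a) ht.2)
    simpa using this
  have hderiv (v : E) : HasStrictFDerivAt F (1 + B (v + v)) v := by
    have h1 : HasStrictFDerivAt (fun v => B v v) (B.precompR E v (.id ℝ E) + B.precompL E (.id ℝ E) v) v :=
      B.hasStrictFDerivAt_of_bilinear (hasStrictFDerivAt_id v) (hasStrictFDerivAt_id v)
    have h2 : HasStrictFDerivAt F _ v := (hasStrictFDerivAt_id v).add h1
    convert h2 using 1
    ext d
    simp [hB d v]
  have hopen : IsOpenMap F := by
    choose u hu using hunit
    refine isOpenMap_of_hasStrictFDerivAt_equiv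
      (f' := fun v => ContinuousLinearEquiv.unitsEquiv ℝ E (u (v + v))) fun v => ?_
    convert hderiv v using 1
    rw [← hu]; rfl
  have hclosed : IsClosed (Set.range F) := by
    refine isClosed_of_closure_subset fun x hx => ?_
    obtain ⟨y, hy, hyx⟩ := mem_closure_iff_seq_limit.1 hx
    choose v hv using hy
    obtain ⟨R, hR⟩ := hyx.norm.bddAbove_range
    obtain ⟨L, hL⟩ := quadratic_lipschitz B hB hlin hbdd R
    have hbd (n) : ‖v n + B (v n) (v n)‖ ≤ R := by
      rw [show v n + B (v n) (v n) = y n from hv n]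
      exact hR ⟨n, rfl⟩
    have hcau : CauchySeq v := by
      have hy' := Metric.cauchySeq_iff.1 hyx.cauchySeq
      refine Metric.cauchySeq_iff.2 fun ε hε => ?_
      obtain ⟨N, hN⟩ := hy' (ε / (|L| + 1)) (by positivity)
      refine ⟨N, fun m hm n hn => ?_⟩
      have h1 := hL (v m) (v n) (hbd m) (hbd n)
      have h2 := hN m hm n hn
      rw [← hv m, ← hv n, dist_eq_norm, lt_div_iff₀ (by positivity)] at h2
      rw [dist_eq_norm]
      have h3 : L * ‖F (v m) - F (v n)‖ ≤ ‖F (v m) - F (v n)‖ * (|L| + 1) := by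
        rw [mul_comm]
        exact mul_le_mul_of_nonneg_left ((le_abs_self L).trans (by linarith)) (norm_nonneg _)
      exact (h1.trans h3).trans_lt h2
    obtain ⟨w, hw⟩ := cauchySeq_tendsto_of_complete hcau
    refine ⟨w, tendsto_nhds_unique ((hcont.tendsto w).comp hw) ?_⟩
    convert hyx using 1
    exact funext hv
  have : Set.range F = Set.univ := IsClopen.eq_univ ⟨hclosed, hopen.isOpen_range⟩ ⟨F 0, 0, rfl⟩
  exact Set.range_eq_univ.1 this

end QuadraticMap
end Miura

namespace Miura
open intervalIntegral Real

/-! ### A priori estimates for continuous functions -/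

section Calculus

/-- Cauchy–Schwarz, from the discriminant of the nonnegative quadratic t ↦ ∫ (tp + q)². -/
theorem sq_integral_mul_le {p q : ℝ → ℝ} (hp : Continuous p) (hq : Continuous q) {a b : ℝ}
    (hab : a ≤ b) :
    (∫ x in a..b, p x * q x) ^ 2 ≤ (∫ x in a..b, p x ^ 2) * ∫ x in a..b, q x ^ 2 := by
  have h (t : ℝ) : 0 ≤ (∫ x in a..b, p x ^ 2) * (t * t) + (2 * ∫ x in a..b, p x * q x) * t +
      ∫ x in a..b, q x ^ 2 := by
    have h1 : 0 ≤ ∫ x in a..b, (p x * t + q x) ^ 2 :=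
      integral_nonneg hab fun x _ => sq_nonneg _
    have h2 : ∫ x in a..b, (p x * t + q x) ^ 2 = ∫ x in a..b,
        (p x ^ 2 * (t * t) + (2 * (p x * q x)) * t + q x ^ 2) := by
      congr 1; ext x; ring
    rw [h2, integral_add (by apply Continuous.intervalIntegrable; fun_prop)
      (by apply Continuous.intervalIntegrable; fun_prop),
      integral_add (by apply Continuous.intervalIntegrable; fun_prop)
      (by apply Continuous.intervalIntegrable; fun_prop), integral_mul_const, integral_mul_const,
      integral_const_mul] at h1
    exact h1
  have := discrim_le_zero h
  rw [discrim] at this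
  nlinarith

theorem abs_sub_le_integral_abs_deriv {g g' : ℝ → ℝ} (hg : ∀ x, HasDerivAt g (g' x) x)
    (hg' : Continuous g') {a b x y : ℝ} (hx : x ∈ Set.Icc a b) (hy : y ∈ Set.Icc a b) :
    |g x - g y| ≤ ∫ t in a..b, |g' t| := by
  rw [← integral_eq_sub_of_hasDerivAt (fun t _ => hg t) (hg'.intervalIntegrable y x)]
  refine (norm_integral_le_integral_norm_uIoc (f := g')).trans ?_
  rw [integral_of_le (hx.1.trans hx.2)]
  refine MeasureTheory.setIntegral_mono_set ?_ (MeasureTheory.ae_of_all _ fun t => norm_nonneg _) ?_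
  · exact (hg'.abs.intervalIntegrable a b).1
  · refine LE.le.eventuallyLE ?_
    intro t ht
    rw [Set.mem_uIoc] at ht
    rcases ht with ht | ht
    · exact ⟨hy.1.trans_lt ht.1, ht.2.trans hx.2⟩
    · exact ⟨hx.1.trans_lt ht.1, ht.2.trans hy.2⟩

theorem hasDerivAt_primitive {v : ℝ → ℝ} (hv : Continuous v) (x : ℝ) :
    HasDerivAt (fun x => ∫ t in (0 : ℝ)..x, v t) (v x) x :=
  (hv.integral_hasStrictDerivAt 0 x).hasDerivAt

/-- The a priori bound behind the properness of the Miura map: if `w' = v² - m`, then `m` is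
controlled by the `L²` norm of `v + w`. -/
theorem mean_sq_le {v w : ℝ → ℝ} {m : ℝ} (hv : Continuous v)
    (hw : ∀ x, HasDerivAt w (v x ^ 2 - m) x) (hw0 : w (2 * π) = w 0)
    (hv0 : ∫ x in (0 : ℝ)..2 * π, v x = 0) :
    m ≤ 2 * (∫ x in (0 : ℝ)..2 * π, (v x + w x) ^ 2) *
      (5 + 4 * ∫ x in (0 : ℝ)..2 * π, (v x + w x) ^ 2) := by
  have hwc : Continuous w := continuous_iff_continuousAt.2 fun x => (hw x).continuousAt
  let V : ℝ → ℝ := fun x => ∫ t in (0 : ℝ)..x, v t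
  have hV (x) : HasDerivAt V (v x) x := hasDerivAt_primitive hv x
  have hVc : Continuous V := continuous_iff_continuousAt.2 fun x => (hV x).continuousAt
  -- This test function is positive, satisfies ψ' = 2vψ, and takes equal values at the endpoints
  -- because v has mean zero.
  let ψ : ℝ → ℝ := fun x => exp (2 * V x)
  have hψ (x) : HasDerivAt ψ (2 * v x * ψ x) x := by
    have := ((hV x).const_mul 2).exp
    convert this using 1
    simp only [ψ]; ring
  have hψc : Continuous ψ := by fun_prop
  have hψpos (x) : 0 < ψ x := exp_pos _
  have hψend : ψ (2 * π) = ψ 0 := by simp [ψ, V, hv0]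
  have hπ := pi_gt_three
  have hT : (0 : ℝ) ≤ 2 * π := by linarith
  set Q := ∫ x in (0 : ℝ)..2 * π, (v x + w x) ^ 2 with hQ
  set S := ∫ x in (0 : ℝ)..2 * π, ψ x with hS
  set X := ∫ x in (0 : ℝ)..2 * π, v x ^ 2 * ψ x with hX
  have hQ0 : 0 ≤ Q := integral_nonneg hT fun x _ => sq_nonneg _
  have hX0 : 0 ≤ X := integral_nonneg hT fun x _ => by have := hψpos x; positivity
  have hSpos : 0 < S := intervalIntegral_pos_of_pos (hψc.intervalIntegrable _ _) hψpos (by linarith)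
  -- Integrate (wψ)' over the period and write w = (v + w) - v: the term 2wvψ reverses the sign of
  -- v²ψ, so X and mS appear on the same side.
  have hident : X + m * S = 2 * ∫ x in (0 : ℝ)..2 * π, (v x + w x) * v x * ψ x := by
    have h1 := integral_eq_sub_of_hasDerivAt (a := 0) (b := 2 * π)
      (fun x _ => (hw x).mul (hψ x)) (by apply Continuous.intervalIntegrable; fun_prop)
    simp only [Pi.mul_apply, hw0, hψend, sub_self] at h1
    have h2 : ∫ x in (0 : ℝ)..2 * π, ((v x ^ 2 - m) * ψ x + w x * (2 * v x * ψ x)) =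
        ∫ x in (0 : ℝ)..2 * π, (2 * ((v x + w x) * v x * ψ x) - (v x ^ 2 * ψ x + m * ψ x)) := by
      congr 1; ext x; ring
    rw [h2, integral_sub (by apply Continuous.intervalIntegrable; fun_prop)
      (by apply Continuous.intervalIntegrable; fun_prop),
      integral_add (by apply Continuous.intervalIntegrable; fun_prop)
      (by apply Continuous.intervalIntegrable; fun_prop), integral_const_mul,
      integral_const_mul] at h1
    linarith
  have hyoung : 2 * ∫ x in (0 : ℝ)..2 * π, (v x + w x) * v x * ψ x ≤
      X / 2 + 2 * ∫ x in (0 : ℝ)..2 * π, (v x + w x) ^ 2 * ψ x := by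
    rw [hX, ← integral_const_mul, ← integral_div, ← integral_const_mul,
      ← integral_add (by apply Continuous.intervalIntegrable; fun_prop)
      (by apply Continuous.intervalIntegrable; fun_prop)]
    refine integral_mono_on hT (by apply Continuous.intervalIntegrable; fun_prop)
      (by apply Continuous.intervalIntegrable; fun_prop) fun x _ => ?_
    have h := mul_nonneg (sq_nonneg (v x - 2 * (v x + w x))) (hψpos x).le
    nlinarith
  -- The weight in Young's inequality for ∫ |ψ'| is chosen so that, after multiplication by 2Q, the
  -- resulting X-term is at most X/2, which is what `hyoung` leaves to absorb.
  have hε : 0 < 4 * (Q + 1) := by linarith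
  have hD : ∫ x in (0 : ℝ)..2 * π, |2 * v x * ψ x| ≤ X / (4 * (Q + 1)) + 4 * (Q + 1) * S := by
    rw [hX, hS, ← integral_div, ← integral_const_mul,
      ← integral_add (by apply Continuous.intervalIntegrable; fun_prop)
      (by apply Continuous.intervalIntegrable; fun_prop)]
    refine integral_mono_on hT (by apply Continuous.intervalIntegrable; fun_prop)
      (by apply Continuous.intervalIntegrable; fun_prop) fun x _ => ?_
    rw [abs_mul, abs_of_pos (hψpos x), abs_mul, abs_two]
    have h : 2 * |v x| ≤ v x ^ 2 / (4 * (Q + 1)) + 4 * (Q + 1) := by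
      rw [← sub_nonneg, ← sq_abs (v x)]
      have : |v x| ^ 2 / (4 * (Q + 1)) + 4 * (Q + 1) - 2 * |v x| =
        (|v x| - 4 * (Q + 1)) ^ 2 / (4 * (Q + 1)) := by field_simp; ring
      rw [this]; positivity
    have := mul_le_mul_of_nonneg_right h (hψpos x).le
    calc _ ≤ _ := this
      _ = _ := by ring
  have hsup : ∀ x ∈ Set.Icc (0 : ℝ) (2 * π), ψ x ≤ S + X / (4 * (Q + 1)) + 4 * (Q + 1) * S := by
    intro x hx
    set D := ∫ x in (0 : ℝ)..2 * π, |2 * v x * ψ x|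
    -- Averaging ψ(x) - D ≤ ψ(y) over y bounds the supremum of ψ by its mean plus ∫ |ψ'|; the mean
    -- is at most S because 2π > 1.
    have h1 : ∫ y in (0 : ℝ)..2 * π, (ψ x - D) ≤ S := by
      refine integral_mono_on hT (by simp) (hψc.intervalIntegrable _ _) fun y hy => ?_
      have := (abs_le.1 (abs_sub_le_integral_abs_deriv hψ (by fun_prop) hx hy)).2
      linarith
    rw [integral_const, smul_eq_mul, sub_zero] at h1
    have h2 : ψ x - D ≤ S := by
      by_contra! hlt
      nlinarith
    linarith
  have hUψ : ∫ x in (0 : ℝ)..2 * π, (v x + w x) ^ 2 * ψ x ≤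
      Q * (S + X / (4 * (Q + 1)) + 4 * (Q + 1) * S) := by
    rw [hQ, ← integral_mul_const]
    refine integral_mono_on hT (by apply Continuous.intervalIntegrable; fun_prop)
      (by apply Continuous.intervalIntegrable; fun_prop) fun x hx => ?_
    exact mul_le_mul_of_nonneg_left (hsup x hx) (sq_nonneg _)
  have hfrac : 2 * (Q * (X / (4 * (Q + 1)))) ≤ X / 2 := by
    have : 2 * (Q * (X / (4 * (Q + 1)))) = X / 2 * (Q / (Q + 1)) := by field_simp; ring
    rw [this]
    exact mul_le_of_le_one_right (by linarith) ((div_le_one (by linarith)).2 (by linarith))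
  have hfin : m * S ≤ (2 * Q * (5 + 4 * Q)) * S := by nlinarith
  exact le_of_mul_le_mul_right hfin hSpos

theorem exists_eq_zero_of_integral_eq_zero {e : ℝ → ℝ} (he : Continuous e) {a b : ℝ} (hab : a < b)
    (h : ∫ x in a..b, e x = 0) : ∃ y ∈ Set.Icc a b, e y = 0 := by
  obtain ⟨y, hy, hey⟩ := exists_deriv_eq_slope (fun x => ∫ t in a..x, e t) hab
    (by
      have : Continuous fun x => ∫ t in a..x, e t := continuous_primitive (fun _ _ => he.intervalIntegrable _ _) a
      exact this.continuousOn)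
    (fun x _ => ((he.integral_hasStrictDerivAt a x).hasDerivAt).differentiableAt.differentiableWithinAt)
  refine ⟨y, Set.Ioo_subset_Icc_self hy, ?_⟩
  rw [(he.integral_hasStrictDerivAt a y).hasDerivAt.deriv, h] at hey
  simpa using hey

/-- The a priori bound for the linearized Miura map, in integrated form: `e' = a d - c` is
controlled by `a` and `d + e`. -/
theorem abs_le_of_linearized {a d e : ℝ → ℝ} {c : ℝ} (ha : Continuous a) (hd : Continuous d)
    (he : ∀ x, HasDerivAt e (a x * d x - c) x) (he0 : e (2 * π) = e 0)
    (ha0 : ∫ x in (0 : ℝ)..2 * π, a x = 0) (hemean : ∫ x in (0 : ℝ)..2 * π, e x = 0)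
    {x : ℝ} (hx : x ∈ Set.Icc 0 (2 * π)) :
    |e x| ≤ 2 * exp (4 * ∫ x in (0 : ℝ)..2 * π, |a x|) *
      ∫ x in (0 : ℝ)..2 * π, |a x| * |d x + e x| := by
  have hec : Continuous e := continuous_iff_continuousAt.2 fun x => (he x).continuousAt
  let A : ℝ → ℝ := fun x => ∫ t in (0 : ℝ)..x, a t
  have hA (x) : HasDerivAt A (a x) x := hasDerivAt_primitive ha x
  have hAc : Continuous A := continuous_iff_continuousAt.2 fun x => (hA x).continuousAt
  have hT : (0 : ℝ) < 2 * π := two_pi_pos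
  set α := ∫ x in (0 : ℝ)..2 * π, |a x| with hα
  set N := ∫ x in (0 : ℝ)..2 * π, |a x| * |d x + e x| with hN
  have hα0 : 0 ≤ α := integral_nonneg hT.le fun x _ => abs_nonneg _
  have hN0 : 0 ≤ N := integral_nonneg hT.le fun x _ => by positivity
  have hAα : ∀ y ∈ Set.Icc (0 : ℝ) (2 * π), |A y| ≤ α := fun y hy => by
    have := abs_sub_le_integral_abs_deriv hA ha hy (Set.left_mem_Icc.2 hT.le)
    simpa [A] using this
  -- With integrating factor exp(A), the equation e' + ae = a(d + e) - c expresses (exp(A) e)'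
  -- through the controlled quantity d + e and the constant c.
  let g' : ℝ → ℝ := fun x => exp (A x) * (a x * (d x + e x) - c)
  have hg (x) : HasDerivAt (fun x => exp (A x) * e x) (g' x) x := by
    refine ((hA x).exp.mul (he x)).congr_deriv ?_
    simp only [g']; ring
  have hg'c : Continuous g' := by fun_prop
  -- As exp(A) e has equal endpoint values, its derivative integrates to zero, which determines c as
  -- a quotient with denominator ∫ exp(A) ≥ 2π exp(-α).
  have hc : 2 * π * |c| ≤ exp (2 * α) * N := by
    have h1 := integral_eq_sub_of_hasDerivAt (a := 0) (b := 2 * π)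
      (fun x _ => hg x) (hg'c.intervalIntegrable _ _)
    have h2 : A (2 * π) = A 0 := by simp [A, ha0]
    simp only [he0, h2, sub_self, g'] at h1
    simp only [mul_sub] at h1
    rw [integral_sub (by apply Continuous.intervalIntegrable; fun_prop)
      (by apply Continuous.intervalIntegrable; fun_prop), integral_mul_const, sub_eq_zero] at h1
    have h3 : 2 * π * exp (-α) ≤ ∫ x in (0 : ℝ)..2 * π, exp (A x) := by
      have : ∫ x in (0 : ℝ)..2 * π, exp (-α) ≤ ∫ x in (0 : ℝ)..2 * π, exp (A x) :=
        integral_mono_on hT.le (by simp) (by apply Continuous.intervalIntegrable; fun_prop)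
          fun x hx => exp_le_exp.2 (abs_le.1 (hAα x hx)).1
      simpa using this
    have h4 : |∫ x in (0 : ℝ)..2 * π, exp (A x) * (a x * (d x + e x))| ≤ exp α * N := by
      refine (abs_integral_le_integral_abs hT.le).trans ?_
      rw [hN, ← integral_const_mul]
      refine integral_mono_on hT.le (by apply Continuous.intervalIntegrable; fun_prop)
        (by apply Continuous.intervalIntegrable; fun_prop) fun x hx => ?_
      rw [abs_mul, abs_mul, abs_of_pos (exp_pos _)]
      exact mul_le_mul_of_nonneg_right (exp_le_exp.2 (abs_le.1 (hAα x hx)).2) (by positivity)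
    have h5 : 2 * π * exp (-α) * |c| ≤ exp α * N := by
      refine (mul_le_mul_of_nonneg_right h3 (abs_nonneg c)).trans (le_trans ?_ h4)
      rw [h1, abs_mul]
      exact mul_le_mul_of_nonneg_right (le_abs_self _) (abs_nonneg c)
    have h6 := mul_le_mul_of_nonneg_left h5 (exp_pos α).le
    calc 2 * π * |c| = exp α * (2 * π * exp (-α) * |c|) := by
          rw [exp_neg]; field_simp
      _ ≤ _ := h6
      _ = exp (2 * α) * N := by rw [two_mul, exp_add]; ring
  have hD : ∫ x in (0 : ℝ)..2 * π, |g' x| ≤ 2 * exp (3 * α) * N := by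
    have h1 : ∫ x in (0 : ℝ)..2 * π, |g' x| ≤
        ∫ x in (0 : ℝ)..2 * π, exp α * (|a x| * |d x + e x| + |c|) := by
      refine integral_mono_on hT.le (by apply Continuous.intervalIntegrable; fun_prop)
        (by apply Continuous.intervalIntegrable; fun_prop) fun x hx => ?_
      simp only [g']
      rw [abs_mul, abs_of_pos (exp_pos _), ← abs_mul (a x)]
      exact mul_le_mul (exp_le_exp.2 (abs_le.1 (hAα x hx)).2) (abs_sub _ _) (abs_nonneg _)
        (exp_pos _).le
    rw [integral_const_mul, integral_add (by apply Continuous.intervalIntegrable; fun_prop)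
      (by simp), integral_const, smul_eq_mul, sub_zero] at h1
    have h2 : exp α * N ≤ exp (3 * α) * N :=
      mul_le_mul_of_nonneg_right (exp_le_exp.2 (by linarith)) hN0
    have h3 : exp α * (2 * π * |c|) ≤ exp (3 * α) * N := by
      have := mul_le_mul_of_nonneg_left hc (exp_pos α).le
      rwa [← mul_assoc _ (exp _), ← exp_add, show α + 2 * α = 3 * α by ring] at this
    linarith
  -- A mean-zero continuous function vanishes somewhere; from that point the bound on ∫ |g'| reaches
  -- every x.
  obtain ⟨y, hy, hey⟩ := exists_eq_zero_of_integral_eq_zero hec hT hemean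
  have h1 := (abs_sub_le_integral_abs_deriv hg hg'c hx hy).trans hD
  rw [hey, mul_zero, sub_zero, abs_mul, abs_of_pos (exp_pos _)] at h1
  have h2 : exp (-α) * |e x| ≤ exp (A x) * |e x| :=
    mul_le_mul_of_nonneg_right (exp_le_exp.2 (abs_le.1 (hAα x hx)).1) (abs_nonneg _)
  have h3 := mul_le_mul_of_nonneg_left (h2.trans h1) (exp_pos α).le
  calc |e x| = exp α * (exp (-α) * |e x|) := by rw [exp_neg]; field_simp
    _ ≤ _ := h3
    _ = 2 * (exp α * exp (3 * α)) * N := by ring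
    _ = 2 * exp (4 * α) * N := by rw [← exp_add]; ring_nf

/-- Use d² ≤ 2(d + e)² + 2e² and the sup bound on e. Cauchy–Schwarz replaces the L¹ quantities in
that bound by L² ones: N² ≤ KQ and α² ≤ 2πK. -/
theorem integral_sq_le_of_linearized {a d e : ℝ → ℝ} {c : ℝ} (ha : Continuous a) (hd : Continuous d)
    (he : ∀ x, HasDerivAt e (a x * d x - c) x) (he0 : e (2 * π) = e 0)
    (ha0 : ∫ x in (0 : ℝ)..2 * π, a x = 0) (hemean : ∫ x in (0 : ℝ)..2 * π, e x = 0) {K : ℝ}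
    (hK : ∫ x in (0 : ℝ)..2 * π, a x ^ 2 ≤ K) :
    ∫ x in (0 : ℝ)..2 * π, d x ^ 2 ≤ (2 + 16 * π * exp (8 * √(2 * π * K)) * K) *
      ∫ x in (0 : ℝ)..2 * π, (d x + e x) ^ 2 := by
  have hec : Continuous e := continuous_iff_continuousAt.2 fun x => (he x).continuousAt
  have hT : (0 : ℝ) < 2 * π := two_pi_pos
  have hsup := fun x (hx : x ∈ Set.Icc 0 (2 * π)) =>
    abs_le_of_linearized ha hd he he0 ha0 hemean hx
  set α := ∫ x in (0 : ℝ)..2 * π, |a x| with hα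
  set N := ∫ x in (0 : ℝ)..2 * π, |a x| * |d x + e x| with hN
  set Q := ∫ x in (0 : ℝ)..2 * π, (d x + e x) ^ 2 with hQ
  have hQ0 : 0 ≤ Q := integral_nonneg hT.le fun x _ => sq_nonneg _
  have hα0 : 0 ≤ α := integral_nonneg hT.le fun x _ => abs_nonneg _
  have hN2 : N ^ 2 ≤ K * Q := by
    have := sq_integral_mul_le ha.abs (hd.add hec).abs hT.le
    simp only [sq_abs, Pi.add_apply] at this
    exact this.trans (mul_le_mul_of_nonneg_right hK hQ0)
  have hα2 : α ≤ √(2 * π * K) := by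
    refine Real.le_sqrt_of_sq_le ?_
    have := sq_integral_mul_le (continuous_const (y := (1 : ℝ))) ha.abs hT.le
    simp only [sq_abs, one_mul, one_pow, integral_const, smul_eq_mul, mul_one, sub_zero] at this
    exact this.trans (mul_le_mul_of_nonneg_left hK hT.le)
  have he2 : ∀ x ∈ Set.Icc 0 (2 * π), e x ^ 2 ≤ 4 * exp (8 * √(2 * π * K)) * (K * Q) := by
    intro x hx
    rw [← sq_abs]
    calc |e x| ^ 2 ≤ (2 * exp (4 * α) * N) ^ 2 := by gcongr; exact hsup x hx
      _ = 4 * exp (8 * α) * N ^ 2 := by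
          rw [mul_pow, mul_pow, ← exp_nat_mul]; push_cast; ring_nf
      _ ≤ _ := by gcongr
  calc ∫ x in (0 : ℝ)..2 * π, d x ^ 2
      ≤ ∫ x in (0 : ℝ)..2 * π, (2 * (d x + e x) ^ 2 + 2 * (4 * exp (8 * √(2 * π * K)) * (K * Q))) := by
        refine integral_mono_on hT.le (by apply Continuous.intervalIntegrable; fun_prop)
          (by apply Continuous.intervalIntegrable; fun_prop) fun x hx => ?_
        nlinarith [he2 x hx, sq_nonneg (d x + 2 * e x)]
    _ = _ := by
        rw [integral_add (by apply Continuous.intervalIntegrable; fun_prop) (by simp),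
          integral_const_mul, integral_const, smul_eq_mul]
        ring

end Calculus
end Miura

namespace Miura
open MeasureTheory Real
open scoped ContDiff

/-! ### Density of trigonometric polynomials among test functions -/

section TrigonometricPolynomials

/-- Real trigonometric polynomials. -/
def trigPoly : Submodule ℝ TestFunction :=
  Submodule.span ℝ (Set.range TestFunction.cos ∪ Set.range TestFunction.sin)

theorem cos_mem_trigPoly (k : ℤ) : TestFunction.cos k ∈ trigPoly :=
  Submodule.subset_span (Or.inl ⟨k, rfl⟩)

theorem sin_mem_trigPoly (k : ℤ) : TestFunction.sin k ∈ trigPoly :=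
  Submodule.subset_span (Or.inr ⟨k, rfl⟩)

theorem cos_zero_apply (x : ℝ) : (TestFunction.cos 0).1 x = 1 := by
  simp [TestFunction.cos]

theorem deriv_cos (k : ℤ) : TestFunction.deriv (TestFunction.cos k) = -(k : ℝ) • TestFunction.sin k := by
  ext x
  have : HasDerivAt (fun x : ℝ => Real.cos (k * x)) (-Real.sin (k * x) * k) x := by
    simpa using ((hasDerivAt_id x).const_mul (k : ℝ)).cos
  refine this.deriv.trans ?_
  simp only [TestFunction.sin, Submodule.coe_smul, Pi.smul_apply, smul_eq_mul]
  ring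

theorem deriv_sin (k : ℤ) : TestFunction.deriv (TestFunction.sin k) = (k : ℝ) • TestFunction.cos k := by
  ext x
  have : HasDerivAt (fun x : ℝ => Real.sin (k * x)) (Real.cos (k * x) * k) x := by
    simpa using ((hasDerivAt_id x).const_mul (k : ℝ)).sin
  refine this.deriv.trans ?_
  simp only [TestFunction.cos, Submodule.coe_smul, Pi.smul_apply, smul_eq_mul]
  ring

theorem sin_zero : TestFunction.sin 0 = 0 := by
  ext x
  simp [TestFunction.sin]

theorem exists_antideriv_trigPoly {p : TestFunction} (hp : p ∈ trigPoly) :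
    ∃ q ∈ trigPoly, ∃ c : ℝ, p = TestFunction.deriv q + c • TestFunction.cos 0 := by
  induction hp using Submodule.span_induction with
  | mem p hp =>
    rcases hp with ⟨k, rfl⟩ | ⟨k, rfl⟩
    · by_cases hk : k = 0
      · exact ⟨0, zero_mem _, 1, by simp [hk]⟩
      · have : (k : ℝ) ≠ 0 := by exact_mod_cast hk
        exact ⟨(k : ℝ)⁻¹ • TestFunction.sin k, trigPoly.smul_mem _ (sin_mem_trigPoly k), 0, by
          simp [deriv_sin, smul_smul, this]⟩
    · by_cases hk : k = 0
      · exact ⟨0, zero_mem _, 0, by simp [hk, sin_zero]⟩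
      · have : (k : ℝ) ≠ 0 := by exact_mod_cast hk
        exact ⟨-(k : ℝ)⁻¹ • TestFunction.cos k, trigPoly.smul_mem _ (cos_mem_trigPoly k), 0, by
          simp [deriv_cos, smul_smul, this]⟩
  | zero => exact ⟨0, zero_mem _, 0, by simp⟩
  | add p p' _ _ h h' =>
    obtain ⟨q, hq, c, rfl⟩ := h
    obtain ⟨q', hq', c', rfl⟩ := h'
    exact ⟨q + q', add_mem hq hq', c + c', by rw [map_add, add_smul]; abel⟩
  | smul r p _ h =>
    obtain ⟨q, hq, c, rfl⟩ := h
    exact ⟨r • q, trigPoly.smul_mem _ hq, r * c, by rw [map_smul, smul_add, smul_smul]⟩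

theorem TestFunction.hasDerivAt (φ : TestFunction) (x : ℝ) :
    HasDerivAt φ.1 ((TestFunction.deriv φ).1 x) x :=
  (φ.2.1.differentiable (by simp) x).hasDerivAt

theorem TestFunction.integral_deriv (φ : TestFunction) :
    ∫ x in (0 : ℝ)..2 * π, (TestFunction.deriv φ).1 x = 0 := by
  rw [intervalIntegral.integral_eq_sub_of_hasDerivAt (fun x _ => TestFunction.hasDerivAt φ x)
    ((TestFunction.deriv φ).2.1.continuous.intervalIntegrable _ _)]
  have := φ.2.2 0
  rw [zero_add] at this
  rw [this, sub_self]

theorem exists_re_im_trigPoly {q : C(AddCircle (2 * π), ℂ)}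
    (hq : q ∈ Submodule.span ℂ (Set.range (@fourier (2 * π)))) :
    (∃ p ∈ trigPoly, ∀ x : ℝ, p.1 x = (q x).re) ∧ ∃ p ∈ trigPoly, ∀ x : ℝ, p.1 x = (q x).im := by
  induction hq using Submodule.span_induction with
  | mem p hp =>
    obtain ⟨n, rfl⟩ := hp
    have h (x : ℝ) : fourier n (x : AddCircle (2 * π)) = Complex.exp (((n * x : ℝ) : ℂ) * Complex.I) := by
      rw [fourier_coe_apply]
      congr 1
      have : (π : ℂ) ≠ 0 := by exact_mod_cast pi_ne_zero
      push_cast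
      field_simp
    refine ⟨⟨_, cos_mem_trigPoly n, fun x => ?_⟩, ⟨_, sin_mem_trigPoly n, fun x => ?_⟩⟩
    · rw [h, Complex.exp_ofReal_mul_I_re]; rfl
    · rw [h, Complex.exp_ofReal_mul_I_im]; rfl
  | zero => exact ⟨⟨0, zero_mem _, by simp⟩, ⟨0, zero_mem _, by simp⟩⟩
  | add p p' _ _ h h' =>
    obtain ⟨⟨r, hr, hrx⟩, ⟨i, hi, hix⟩⟩ := h
    obtain ⟨⟨r', hr', hrx'⟩, ⟨i', hi', hix'⟩⟩ := h'
    exact ⟨⟨r + r', add_mem hr hr', fun x => by simp [hrx, hrx']⟩,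
      ⟨i + i', add_mem hi hi', fun x => by simp [hix, hix']⟩⟩
  | smul c p _ h =>
    obtain ⟨⟨r, hr, hrx⟩, ⟨i, hi, hix⟩⟩ := h
    exact ⟨⟨c.re • r - c.im • i, sub_mem (trigPoly.smul_mem _ hr) (trigPoly.smul_mem _ hi),
      fun x => by simp [hrx, hix]⟩, ⟨c.re • i + c.im • r,
      add_mem (trigPoly.smul_mem _ hi) (trigPoly.smul_mem _ hr), fun x => by simp [hrx, hix]⟩⟩

theorem exists_trigPoly_near (φ : TestFunction) {ε : ℝ} (hε : 0 < ε) :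
    ∃ p ∈ trigPoly, ∀ x, |φ.1 x - p.1 x| ≤ ε := by
  have : Fact (0 < 2 * π) := ⟨two_pi_pos⟩
  have hper : Function.Periodic (fun x => (φ.1 x : ℂ)) (2 * π) := fun x => by
    simp only [φ.2.2 x]
  let Φ : C(AddCircle (2 * π), ℂ) := ⟨hper.lift, by
    have : Continuous fun x => (φ.1 x : ℂ) := Complex.continuous_ofReal.comp φ.2.1.continuous
    exact continuous_coinduced_dom.mpr this⟩
  have hΦ : Φ ∈ (Submodule.span ℂ (Set.range (@fourier (2 * π)))).topologicalClosure := by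
    rw [span_fourier_closure_eq_top]; trivial
  obtain ⟨q, hq, hqΦ⟩ := Metric.mem_closure_iff.1 hΦ ε hε
  obtain ⟨⟨p, hp, hpx⟩, -⟩ := exists_re_im_trigPoly hq
  refine ⟨p, hp, fun x => ?_⟩
  have h1 : ‖(Φ - q) (x : AddCircle (2 * π))‖ ≤ ‖Φ - q‖ := ContinuousMap.norm_coe_le_norm _ _
  rw [dist_eq_norm] at hqΦ
  have h2 := (Complex.abs_re_le_norm _).trans (h1.trans hqΦ.le)
  rw [hpx]
  exact h2

/-- A distribution has finite order, so density is needed in every C^N norm. Induct on N: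
approximate φ', then integrate the approximant after removing its mean. -/
theorem exists_trigPoly_near_iteratedDeriv (N : ℕ) : ∀ (φ : TestFunction) {ε : ℝ}, 0 < ε →
    ∃ p ∈ trigPoly, ∀ j ≤ N, ∀ x, |iteratedDeriv j (φ - p).1 x| ≤ ε := by
  induction N with
  | zero =>
    intro φ ε hε
    obtain ⟨p, hp, h⟩ := exists_trigPoly_near φ hε
    refine ⟨p, hp, fun j hj x => ?_⟩
    obtain rfl : j = 0 := by omega
    rw [iteratedDeriv_zero]
    exact h x
  | succ N ih =>
    intro φ ε hε
    -- The error δ in φ' doubles when the mean c is dropped; integrating it over a period costs a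
    -- further factor 2π for φ itself.
    obtain ⟨δ, hδ, hδ1, hδ2⟩ : ∃ δ > 0, 2 * δ ≤ ε ∧ 2 * δ * (2 * π) ≤ ε := by
      have := pi_pos
      refine ⟨ε / (2 * (1 + 2 * π)), by positivity, ?_, ?_⟩
      · rw [mul_div_assoc', div_le_iff₀ (by positivity)]; nlinarith
      · rw [mul_div_assoc', div_mul_eq_mul_div, div_le_iff₀ (by positivity)]; nlinarith
    obtain ⟨p, hp, hpφ⟩ := ih (TestFunction.deriv φ) hδ
    obtain ⟨q, hq, c, hqc⟩ := exists_antideriv_trigPoly hp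
    have hpφ0 (x : ℝ) : |(TestFunction.deriv φ - p).1 x| ≤ δ := by
      simpa using hpφ 0 (Nat.zero_le _) x
    -- Since φ' has mean zero, the mean of its approximant is no larger than the approximation
    -- error.
    have hc : |c| ≤ δ := by
      have h1 : ∫ x in (0 : ℝ)..2 * π, (TestFunction.deriv φ - p).1 x = -(2 * π * c) := by
        have h2 : ∀ x, (TestFunction.deriv φ - p).1 x = (TestFunction.deriv (φ - q)).1 x - c := by
          intro x
          rw [hqc, map_sub]
          simp only [Submodule.coe_sub, Submodule.coe_add, Submodule.coe_smul, Pi.sub_apply,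
            Pi.add_apply, Pi.smul_apply, cos_zero_apply, smul_eq_mul]
          ring
        simp only [h2]
        rw [intervalIntegral.integral_sub
          ((TestFunction.deriv (φ - q)).2.1.continuous.intervalIntegrable _ _) (by simp),
          TestFunction.integral_deriv]
        simp
      have h3 := intervalIntegral.norm_integral_le_of_norm_le_const (a := 0) (b := 2 * π)
        (f := (TestFunction.deriv φ - p).1) (C := δ) fun x _ => hpφ0 x
      rw [h1, norm_neg, Real.norm_eq_abs, abs_mul, abs_of_pos two_pi_pos, sub_zero,
        abs_of_pos two_pi_pos, mul_comm] at h3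
      exact le_of_mul_le_mul_right h3 two_pi_pos
    let r : TestFunction := q + (φ.1 0 - q.1 0) • TestFunction.cos 0
    have hr : r ∈ trigPoly := add_mem hq (trigPoly.smul_mem _ (cos_mem_trigPoly 0))
    have hder : (TestFunction.deriv (φ - r)).1 = fun x => (TestFunction.deriv φ - p).1 x + c := by
      ext x
      simp only [r, hqc, map_sub, map_add, map_smul, deriv_cos]
      simp [cos_zero_apply]
      ring
    refine ⟨r, hr, fun j hj x => ?_⟩
    rcases j with _ | j
    · rw [iteratedDeriv_zero]
      obtain ⟨y, hy, hxy⟩ := (φ - r).2.2.exists_mem_Ico₀ two_pi_pos x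
      rw [hxy]
      have h0 : (φ - r).1 0 = 0 := by simp [r, cos_zero_apply]
      have h1 := Convex.norm_image_sub_le_of_norm_hasDerivWithin_le (f := (φ - r).1)
        (f' := (TestFunction.deriv (φ - r)).1) (C := 2 * δ) (s := Set.univ) (x := 0) (y := y)
        (fun x _ => (TestFunction.hasDerivAt (φ - r) x).hasDerivWithinAt) (fun x _ => by
          rw [hder]
          refine (abs_add_le _ _).trans ?_
          linarith [hpφ0 x]) convex_univ trivial trivial
      rw [h0, sub_zero, sub_zero, Real.norm_eq_abs, Real.norm_eq_abs, abs_of_nonneg hy.1] at h1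
      refine h1.trans (le_trans ?_ hδ2)
      exact mul_le_mul_of_nonneg_left hy.2.le (by positivity)
    · rw [iteratedDeriv_succ']
      change |iteratedDeriv j (TestFunction.deriv (φ - r)).1 x| ≤ ε
      rw [hder, iteratedDeriv_fun_add (((TestFunction.deriv φ - p).2.1.of_le (by exact_mod_cast le_top)).contDiffAt) contDiffAt_const,
        iteratedDeriv_const]
      refine (abs_add_le _ _).trans ?_
      have h1 := hpφ j (by omega) x
      have h2 : |if j = 0 then c else 0| ≤ δ := by
        split_ifs
        · exact hc
        · simpa using hδ.le
      linarith

end TrigonometricPolynomials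

/-! ### Fourier coefficients of distributions -/

section Coefficients

/-- The difference vanishes on trigonometric polynomials, which are dense in the C^N norm that
bounds it. -/
theorem Distribution.ext_cos_sin {u v : Distribution}
    (hcos : ∀ k, u.1 (TestFunction.cos k) = v.1 (TestFunction.cos k))
    (hsin : ∀ k, u.1 (TestFunction.sin k) = v.1 (TestFunction.sin k)) : u = v := by
  have hspan : ∀ p ∈ trigPoly, (u - v).1 p = 0 := by
    intro p hp
    induction hp using Submodule.span_induction with
    | mem p hp =>
      rcases hp with ⟨k, rfl⟩ | ⟨k, rfl⟩
      · simp [hcos k]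
      · simp [hsin k]
    | zero => simp
    | add p q _ _ hp hq => rw [map_add, hp, hq, add_zero]
    | smul c p _ hp => rw [map_smul, hp, smul_zero]
  rw [← sub_eq_zero]
  ext φ
  obtain ⟨N, C, hC⟩ := (u - v).2
  have hle : ∀ ε > 0, |(u - v).1 φ| ≤ C * ε := fun ε hε => by
    obtain ⟨p, hp, h⟩ := exists_trigPoly_near_iteratedDeriv N φ hε
    have := hC (φ - p) ε h
    rwa [map_sub, hspan p hp, sub_zero] at this
  have h0 : |(u - v).1 φ| ≤ 0 := by
    refine ge_of_tendsto (x := nhdsWithin 0 (Set.Ioi 0)) (f := fun ε : ℝ => C * ε) ?_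
      (Filter.eventually_of_mem self_mem_nhdsWithin hle)
    have : Filter.Tendsto (fun ε : ℝ => C * ε) (nhds 0) (nhds (C * 0)) :=
      (continuous_const.mul continuous_id).tendsto 0
    rw [mul_zero] at this
    exact this.mono_left nhdsWithin_le_nhds
  exact abs_nonpos_iff.1 h0

theorem fourierCoeff_re_im (u : Distribution) (k : ℤ) :
    u.1 (TestFunction.cos k) = 2 * π * (fourierCoeff u k).re ∧
      u.1 (TestFunction.sin k) = -(2 * π * (fourierCoeff u k).im) := by
  have hπ := pi_ne_zero
  have h : fourierCoeff u k = ((1 / (2 * π) * u.1 (TestFunction.cos k) : ℝ) : ℂ) +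
      ((-(1 / (2 * π) * u.1 (TestFunction.sin k)) : ℝ) : ℂ) * Complex.I := by
    rw [fourierCoeff]; push_cast; ring
  rw [h]
  constructor
  · simp; field_simp
  · simp; field_simp

/-- A distribution is determined by its Fourier coefficients. -/
theorem Distribution.ext_fourierCoeff {u v : Distribution} (h : fourierCoeff u = fourierCoeff v) :
    u = v :=
  Distribution.ext_cos_sin
    (fun k => by rw [(fourierCoeff_re_im u k).1, (fourierCoeff_re_im v k).1, h])
    (fun k => by rw [(fourierCoeff_re_im u k).2, (fourierCoeff_re_im v k).2, h])

theorem fourierCoeff_add (u v : Distribution) (k : ℤ) :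
    fourierCoeff (u + v) k = fourierCoeff u k + fourierCoeff v k := by
  simp [fourierCoeff]; ring

theorem fourierCoeff_sub (u v : Distribution) (k : ℤ) :
    fourierCoeff (u - v) k = fourierCoeff u k - fourierCoeff v k := by
  simp [fourierCoeff]; ring

theorem fourierCoeff_zero (k : ℤ) : fourierCoeff 0 k = 0 := by simp [fourierCoeff]

theorem fourierCoeff_neg (u : Distribution) (k : ℤ) :
    fourierCoeff u (-k) = starRingEnd ℂ (fourierCoeff u k) := by
  have h1 : TestFunction.cos (-k) = TestFunction.cos k := by
    ext x; simp [TestFunction.cos]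
  have h2 : TestFunction.sin (-k) = -TestFunction.sin k := by
    ext x; simp [TestFunction.sin]
  simp [fourierCoeff, h1, h2, map_ofNat]

theorem fourierCoeff_dx (u : Distribution) (k : ℤ) :
    fourierCoeff (dx u) k = Complex.I * k * fourierCoeff u k := by
  have h1 : (dx u).1 (TestFunction.cos k) = k * u.1 (TestFunction.sin k) := by
    simp [dx, deriv_cos]
  have h2 : (dx u).1 (TestFunction.sin k) = -(k * u.1 (TestFunction.cos k)) := by
    simp [dx, deriv_sin]
  rw [fourierCoeff, fourierCoeff, h1, h2]
  push_cast
  linear_combination (1 / (2 * π : ℂ) * k * u.1 (TestFunction.sin k)) * Complex.I_sq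

/-- Fourier coefficients of a function on the period. -/
noncomputable def coef (f : ℝ → ℂ) (k : ℤ) : ℂ :=
  (1 / (2 * π) : ℂ) * ∫ x in Set.Ioc 0 (2 * π), f x * Complex.exp (-(k * x * Complex.I))

theorem fourierCoeff_of_forall_eq_integral {u : Distribution} {f : ℝ → ℝ}
    (hf : IntegrableOn f (Set.Ioc 0 (2 * π)))
    (hu : ∀ φ : TestFunction, u.1 φ = ∫ x in Set.Ioc 0 (2 * π), f x * φ.1 x) (k : ℤ) :
    fourierCoeff u k = coef (fun x => f x) k := by
  have key (φ : TestFunction) :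
      IntegrableOn (fun x => ((f x * φ.1 x : ℝ) : ℂ)) (Set.Ioc 0 (2 * π)) :=
    (hf.mul_continuousOn_of_subset φ.2.1.continuous.continuousOn measurableSet_Ioc isCompact_Icc
      Set.Ioc_subset_Icc_self).ofReal
  rw [fourierCoeff, coef, hu, hu, ← integral_complex_ofReal, ← integral_complex_ofReal, ← integral_const_mul,
    ← integral_sub (key _) ((key _).const_mul _)]
  congr 2
  ext x
  have : -((k : ℂ) * x * Complex.I) = ((-(k * x) : ℝ) : ℂ) * Complex.I := by push_cast; ring
  rw [this, Complex.exp_mul_I, ← Complex.ofReal_cos, ← Complex.ofReal_sin, Real.cos_neg,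
    Real.sin_neg]
  simp only [TestFunction.cos, TestFunction.sin]
  push_cast
  ring

theorem fourierCoeff_ofFun {f : ℝ → ℝ} (hf : IntegrableOn f (Set.Ioc 0 (2 * π))) (k : ℤ) :
    fourierCoeff (ofFun f hf) k = coef (fun x => f x) k :=
  fourierCoeff_of_forall_eq_integral hf (fun _ => rfl) k

theorem integral_exp_neg_int_mul (k : ℤ) :
    ∫ x in Set.Ioc 0 (2 * π), Complex.exp (-(k * x * Complex.I)) = if k = 0 then 2 * π else 0 := by
  rw [← intervalIntegral.integral_of_le two_pi_pos.le]
  split_ifs with hk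
  · simp [hk]
  · have hk' : (-(k * Complex.I) : ℂ) ≠ 0 := by simp [hk]
    have : (fun x : ℝ => Complex.exp (-(k * x * Complex.I))) =
      fun x : ℝ => Complex.exp ((-(k * Complex.I)) * x) := by ext x; ring_nf
    rw [this, integral_exp_mul_complex hk']
    have h1 : Complex.exp (-(k * Complex.I) * ((2 * π : ℝ) : ℂ)) = 1 := by
      rw [Complex.exp_eq_one_iff]
      exact ⟨-k, by push_cast; ring⟩
    rw [h1]
    simp

theorem fourierCoeff_P0 (u : Distribution) (k : ℤ) :
    fourierCoeff (P0 u) k = if k = 0 then fourierCoeff u 0 else 0 := by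
  rw [P0, fourierCoeff_ofFun, coef, integral_const_mul, integral_exp_neg_int_mul]
  split_ifs with hk
  · have : (π : ℂ) ≠ 0 := by exact_mod_cast pi_ne_zero
    rw [fourierCoeff, sin_zero]
    simp
    field_simp
  · simp

theorem P0_eq_zero_iff (u : Distribution) : P0 u = 0 ↔ fourierCoeff u 0 = 0 := by
  constructor
  · intro h
    have := fourierCoeff_P0 u 0
    rw [h, fourierCoeff_zero, if_pos rfl] at this
    exact this.symm
  · intro h
    refine Distribution.ext_fourierCoeff (funext fun k => ?_)
    rw [fourierCoeff_P0, h, ite_self, fourierCoeff_zero]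

end Coefficients
end Miura

namespace Miura
open MeasureTheory Real

/-! ### Parseval, products and Riesz–Fischer on the period -/

section SquareIntegrable

theorem fact_two_pi_pos : Fact (0 < 2 * π) := ⟨two_pi_pos⟩

attribute [local instance] fact_two_pi_pos

/-- Lebesgue measure on the period. -/
noncomputable abbrev periodMeasure : Measure ℝ := volume.restrict (Set.Ioc 0 (2 * π))

theorem fourier_neg_coe_two_pi (k : ℤ) (x : ℝ) :
    fourier (-k) (x : AddCircle (2 * π)) = Complex.exp (-(k * x * Complex.I)) := by
  rw [fourier_coe_apply]
  congr 1
  have : (π : ℂ) ≠ 0 := by exact_mod_cast pi_ne_zero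
  push_cast
  field_simp

theorem fourierCoeff_circle_eq_coef (g : AddCircle (2 * π) → ℂ) (k : ℤ) :
    _root_.fourierCoeff g k = coef (fun x => g x) k := by
  rw [fourierCoeff_eq_intervalIntegral g k 0, zero_add, coef,
    intervalIntegral.integral_of_le two_pi_pos.le, Complex.real_smul]
  push_cast
  congr 2
  ext x
  rw [fourier_neg_coe_two_pi, smul_eq_mul, mul_comm]

theorem coef_congr {f g : ℝ → ℂ} (h : ∀ x ∈ Set.Ioc 0 (2 * π), f x = g x) : coef f = coef g := by
  ext k
  rw [coef, coef]
  congr 1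
  exact setIntegral_congr_fun measurableSet_Ioc fun x hx => by simp only [h x hx]

theorem fourierCoeff_liftIoc_eq_coef (f : ℝ → ℂ) (k : ℤ) :
    _root_.fourierCoeff (AddCircle.liftIoc (2 * π) 0 f) k = coef f k := by
  rw [fourierCoeff_circle_eq_coef]
  refine congrFun (coef_congr fun x hx => ?_) k
  exact AddCircle.liftIoc_coe_apply (by rwa [zero_add])

/-- Parseval's identity in polarized form. -/
theorem hasSum_conj_coef_mul_coef {f g : ℝ → ℂ} (hf : MemLp f 2 periodMeasure)
    (hg : MemLp g 2 periodMeasure) :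
    HasSum (fun j => starRingEnd ℂ (coef f j) * coef g j)
      ((1 / (2 * π) : ℂ) * ∫ x in Set.Ioc 0 (2 * π), starRingEnd ℂ (f x) * g x) := by
  have hlift {f : ℝ → ℂ} (hf : MemLp f 2 periodMeasure) :
      MemLp (AddCircle.liftIoc (2 * π) 0 f) 2 AddCircle.haarAddCircle := by
    refine MemLp.haarAddCircle (MemLp.memLp_liftIoc ?_)
    rwa [zero_add]
  let F := (hlift hf).toLp
  let G := (hlift hg).toLp
  have hrepr {f : ℝ → ℂ} (hf : MemLp f 2 periodMeasure) (j : ℤ) :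
      fourierBasis.repr (hlift hf).toLp j = coef f j := by
    rw [fourierBasis_repr, fourierCoeff_congr_ae (hlift hf).coeFn_toLp,
      fourierCoeff_liftIoc_eq_coef]
  have h := fourierBasis.hasSum_inner_mul_inner F G
  have e1 : (fun j => starRingEnd ℂ (coef f j) * coef g j) =
      fun j => inner ℂ F (fourierBasis j) * inner ℂ (fourierBasis j) G := by
    ext j
    rw [← fourierBasis.repr_apply_apply, ← inner_conj_symm, ← fourierBasis.repr_apply_apply,
      hrepr hg, hrepr hf]
  have e2 : (1 / (2 * π) : ℂ) * ∫ x in Set.Ioc 0 (2 * π), starRingEnd ℂ (f x) * g x =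
      inner ℂ F G := by
    rw [L2.inner_def]
    have h1 : (fun x => inner ℂ (F x) (G x)) =ᵐ[AddCircle.haarAddCircle]
        AddCircle.liftIoc (2 * π) 0 (fun x => starRingEnd ℂ (f x) * g x) := by
      filter_upwards [(hlift hf).coeFn_toLp, (hlift hg).coeFn_toLp] with x hx hx'
      rw [hx, hx', RCLike.inner_apply']
      rfl
    rw [integral_congr_ae h1, AddCircle.integral_haarAddCircle,
      AddCircle.integral_liftIoc_eq_intervalIntegral, zero_add,
      intervalIntegral.integral_of_le two_pi_pos.le, Complex.real_smul]
    push_cast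
    rw [one_div]
  rw [e1, e2]
  exact h

theorem exp_neg_mul_memLp {f : ℝ → ℂ} (hf : MemLp f 2 periodMeasure) (k : ℤ) :
    MemLp (fun x => f x * Complex.exp (-(k * x * Complex.I))) 2 periodMeasure := by
  refine hf.of_le (hf.1.mul (by fun_prop)) (ae_of_all _ fun x => ?_)
  have : -((k : ℂ) * x * Complex.I) = ((-(k * x) : ℝ) : ℂ) * Complex.I := by push_cast; ring
  rw [norm_mul, this, Complex.norm_exp_ofReal_mul_I, mul_one]

theorem coef_mul_exp (f : ℝ → ℂ) (k j : ℤ) :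
    coef (fun x => f x * Complex.exp (-(k * x * Complex.I))) j = coef f (j + k) := by
  rw [coef, coef]
  congr 2
  ext x
  rw [mul_assoc, ← Complex.exp_add]
  push_cast
  ring_nf

theorem coef_conj (f : ℝ → ℂ) (k : ℤ) :
    coef (fun x => starRingEnd ℂ (f x)) k = starRingEnd ℂ (coef f (-k)) := by
  rw [coef, coef, map_mul, ← integral_conj]
  congr 1
  · simp [map_ofNat]
  · congr 1
    ext x
    rw [map_mul, ← Complex.exp_conj]
    simp

theorem coef_ofReal_neg (f : ℝ → ℝ) (k : ℤ) :
    coef (fun x => f x) (-k) = starRingEnd ℂ (coef (fun x => f x) k) := by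
  have := coef_conj (fun x => (f x : ℂ)) (-k)
  simpa using this

/-- The Fourier coefficients of a product of real square-integrable functions. -/
theorem hasSum_coef_mul {f g : ℝ → ℝ} (hf : MemLp f 2 periodMeasure) (hg : MemLp g 2 periodMeasure)
    (k : ℤ) :
    HasSum (fun j => coef (fun x => f x) (k - j) * coef (fun x => g x) j)
      (coef (fun x => ((f x * g x : ℝ) : ℂ)) k) := by
  -- Parseval for f e^{ikx} and g: the j-th coefficient of the first is that of f at j - k, whose
  -- conjugate is the one at k - j because f is real.
  have h := hasSum_conj_coef_mul_coef (exp_neg_mul_memLp (hf.ofReal (K := ℂ)) (-k)) (hg.ofReal (K := ℂ))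
  convert h using 1
  · ext j
    have := coef_mul_exp (fun x => (f x : ℂ)) (-k) j
    refine congrArg₂ _ ?_ rfl
    refine Eq.trans ?_ (congrArg (starRingEnd ℂ) this.symm)
    rw [← coef_ofReal_neg]
    congr 1; ring
  · rw [coef]
    congr 2
    ext x
    rw [map_mul, ← Complex.exp_conj]
    simp
    ring

theorem integral_sq_eq {f : ℝ → ℝ} (hf : MemLp f 2 periodMeasure) :
    HasSum (fun j => ‖coef (fun x => f x) j‖ ^ 2)
      (1 / (2 * π) * ∫ x in Set.Ioc 0 (2 * π), f x ^ 2) := by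
  have h := hasSum_conj_coef_mul_coef (hf.ofReal (K := ℂ)) (hf.ofReal (K := ℂ))
  rw [← Complex.hasSum_ofReal]
  convert h using 1
  · ext j
    rw [mul_comm, Complex.mul_conj, Complex.normSq_eq_norm_sq]
    rfl
  · push_cast
    rw [← integral_complex_ofReal]
    congr 2
    ext x
    change ((f x ^ 2 : ℝ) : ℂ) = starRingEnd ℂ (f x : ℂ) * (f x : ℂ)
    rw [Complex.conj_ofReal]
    push_cast
    exact pow_two _

/-- The Riesz–Fischer theorem for real functions. -/
theorem exists_memLp_coef_eq (a : lp (fun _ : ℤ => ℂ) 2) (ha : ∀ k, a (-k) = starRingEnd ℂ (a k)) :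
    ∃ f : ℝ → ℝ, MemLp f 2 periodMeasure ∧ coef (fun x => f x) = a := by
  let g := (fourierBasis (T := 2 * π)).repr.symm a
  have hg : MemLp (fun x : ℝ => g (x : AddCircle (2 * π))) 2 periodMeasure := by
    have h1 : MemLp g 2 (volume : Measure (AddCircle (2 * π))) := (Lp.memLp g).of_haarAddCircle
    have h2 := h1.comp_measurePreserving (AddCircle.measurePreserving_mk (2 * π) 0)
    rwa [zero_add] at h2
  have hcoef (k : ℤ) : coef (fun x : ℝ => g (x : AddCircle (2 * π))) k = a k := by
    rw [← fourierCoeff_circle_eq_coef, ← fourierBasis_repr]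
    simp [g]
  -- Taking the real part changes no coefficient, by the symmetry `ha`.
  refine ⟨fun x => (g (x : AddCircle (2 * π))).re, hg.re, funext fun k => ?_⟩
  have h1 : coef (fun x : ℝ => (((g (x : AddCircle (2 * π))).re : ℝ) : ℂ)) k =
      (coef (fun x : ℝ => g (x : AddCircle (2 * π))) k +
        coef (fun x : ℝ => starRingEnd ℂ (g (x : AddCircle (2 * π)))) k) / 2 := by
    rw [coef, coef, coef, ← mul_add, ← integral_add, mul_div_assoc, ← integral_div]
    · congr 2
      ext x
      rw [Complex.re_eq_add_conj]; ring
    · exact (exp_neg_mul_memLp hg k).integrable (by norm_num)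
    · exact (exp_neg_mul_memLp hg.star k).integrable (by norm_num)
  rw [h1, coef_conj, hcoef, hcoef, ha, Complex.conj_conj]
  ring

theorem coef_of_hasDerivAt {e e' : ℝ → ℂ} (he : ∀ x, HasDerivAt e (e' x) x) (he' : Continuous e')
    (he0 : e (2 * π) = e 0) (k : ℤ) : coef e' k = Complex.I * k * coef e k := by
  have hec : Continuous e := continuous_iff_continuousAt.2 fun x => (he x).continuousAt
  have hexp (x : ℝ) : HasDerivAt (fun x : ℝ => Complex.exp (-(k * x * Complex.I)))
      (Complex.exp (-(k * x * Complex.I)) * (-(k * Complex.I))) x := by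
    have h1 : HasDerivAt (fun x : ℝ => (-(k * x * Complex.I) : ℂ)) (-(k * Complex.I)) x := by
      have := ((Complex.ofRealCLM.hasDerivAt (x := x)).const_mul (k : ℂ)).mul_const Complex.I
      simpa using this.fun_neg
    exact h1.cexp
  have h := intervalIntegral.integral_eq_sub_of_hasDerivAt (a := 0) (b := 2 * π)
    (fun x _ => (he x).mul (hexp x)) (by apply Continuous.intervalIntegrable; fun_prop)
  have h1 : Complex.exp (-(k * ((2 * π : ℝ) : ℂ) * Complex.I)) = 1 := by
    rw [Complex.exp_eq_one_iff]
    exact ⟨-k, by push_cast; ring⟩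
  simp only [Pi.mul_apply, h1, he0] at h
  rw [intervalIntegral.integral_add (by apply Continuous.intervalIntegrable; fun_prop)
    (by apply Continuous.intervalIntegrable; fun_prop)] at h
  simp only [← mul_assoc] at h
  rw [intervalIntegral.integral_mul_const, intervalIntegral.integral_of_le two_pi_pos.le,
    intervalIntegral.integral_of_le two_pi_pos.le] at h
  simp only [Complex.ofReal_zero, mul_zero, zero_mul, neg_zero, Complex.exp_zero, sub_self] at h
  rw [coef, coef]
  linear_combination (1 / (2 * π) : ℂ) * h

end SquareIntegrable
end Miura

namespace Miura
open scoped ENNReal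

/-! ### Weighted sequence norms and the smoothing estimate -/

section WeightedNorms

/-- The `ℓ²(ℤ)` norm of a sequence of extended nonnegative reals. -/
noncomputable def l2Norm (f : ℤ → ℝ≥0∞) : ℝ≥0∞ := (∑' k, f k ^ (2 : ℝ)) ^ (1 / 2 : ℝ)

theorem l2Norm_mono {f g : ℤ → ℝ≥0∞} (h : ∀ k, f k ≤ g k) : l2Norm f ≤ l2Norm g :=
  ENNReal.rpow_le_rpow (ENNReal.tsum_le_tsum fun k => ENNReal.rpow_le_rpow (h k) (by norm_num))
    (by norm_num)

theorem l2Norm_const_mul (c : ℝ≥0∞) (f : ℤ → ℝ≥0∞) :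
    l2Norm (fun k => c * f k) = c * l2Norm f := by
  rw [l2Norm, l2Norm]
  simp only [ENNReal.mul_rpow_of_nonneg _ _ (zero_le_two : (0 : ℝ) ≤ 2)]
  rw [ENNReal.tsum_mul_left, ENNReal.mul_rpow_of_nonneg _ _ (by norm_num), ← ENNReal.rpow_mul]
  norm_num

theorem l2Norm_add_le (f g : ℤ → ℝ≥0∞) : l2Norm (fun k => f k + g k) ≤ l2Norm f + l2Norm g := by
  have := ENNReal.lintegral_Lp_add_le (μ := MeasureTheory.Measure.count) (p := 2)
    (f := f) (g := g) (measurable_of_countable f).aemeasurable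
    (measurable_of_countable g).aemeasurable one_le_two
  simpa [MeasureTheory.lintegral_count, l2Norm] using this

theorem tsum_convolution_le (f g : ℤ → ℝ≥0∞) (k : ℤ) :
    ∑' j, f (k - j) * g j ≤ l2Norm f * l2Norm g := by
  have h := ENNReal.lintegral_mul_le_Lp_mul_Lq (MeasureTheory.Measure.count)
    (f := fun j => f (k - j)) (g := g) Real.HolderConjugate.two_two
    (measurable_of_countable _).aemeasurable (measurable_of_countable g).aemeasurable
  simp only [MeasureTheory.lintegral_count, Pi.mul_apply] at h
  have h1 : ∑' j, f (k - j) ^ (2 : ℝ) = ∑' j, f j ^ (2 : ℝ) :=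
    (Equiv.subLeft k).tsum_eq fun j => f j ^ (2 : ℝ)
  rwa [h1] at h

/-- The weight `⟨k⟩ = (1 + k²)^{1/2}`. -/
noncomputable def bracket (k : ℤ) : ℝ := √(1 + (k : ℝ) ^ 2)

theorem one_le_bracket (k : ℤ) : 1 ≤ bracket k :=
  Real.one_le_sqrt.2 (by nlinarith [sq_nonneg (k : ℝ)])

theorem bracket_pos (k : ℤ) : 0 < bracket k := zero_lt_one.trans_le (one_le_bracket k)

theorem abs_le_bracket (k : ℤ) : |(k : ℝ)| ≤ bracket k :=
  Real.abs_le_sqrt (by linarith)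

theorem bracket_le_two_mul_abs {k : ℤ} (hk : k ≠ 0) : bracket k ≤ 2 * |(k : ℝ)| := by
  have h1 : (1 : ℝ) ≤ |(k : ℝ)| := by exact_mod_cast Int.one_le_abs hk
  refine Real.sqrt_le_iff.2 ⟨by positivity, ?_⟩
  rw [mul_pow, sq_abs]
  nlinarith [sq_abs (k : ℝ)]

theorem bracket_le_add (k j : ℤ) : bracket k ≤ bracket (k - j) + bracket j := by
  have h1 := one_le_bracket (k - j)
  have h2 := one_le_bracket j
  refine Real.sqrt_le_iff.2 ⟨by linarith, ?_⟩
  have h3 : bracket (k - j) ^ 2 = 1 + ((k - j : ℤ) : ℝ) ^ 2 := Real.sq_sqrt (by positivity)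
  have h4 : bracket j ^ 2 = 1 + (j : ℝ) ^ 2 := Real.sq_sqrt (by positivity)
  have h5 := mul_le_mul (abs_le_bracket (k - j)) (abs_le_bracket j) (abs_nonneg _) (by linarith)
  rw [← abs_mul] at h5
  have h6 := (le_abs_self _).trans h5
  push_cast at h3 h6
  nlinarith

/-- The weight `⟨k⟩^σ` in `ℝ≥0∞`. -/
noncomputable def weight (σ : ℝ) (k : ℤ) : ℝ≥0∞ := ENNReal.ofReal (bracket k ^ σ)

theorem weight_add (σ τ : ℝ) (k : ℤ) : weight (σ + τ) k = weight σ k * weight τ k := by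
  rw [weight, weight, weight, Real.rpow_add (bracket_pos k),
    ENNReal.ofReal_mul (Real.rpow_nonneg (bracket_pos k).le _)]

theorem weight_zero (k : ℤ) : weight 0 k = 1 := by simp [weight]

theorem weight_mono {σ τ : ℝ} (h : σ ≤ τ) (k : ℤ) : weight σ k ≤ weight τ k :=
  ENNReal.ofReal_le_ofReal (Real.rpow_le_rpow_of_exponent_le (one_le_bracket k) h)

theorem weight_le_add {σ : ℝ} (hσ : 0 ≤ σ) (k j : ℤ) :
    weight σ k ≤ ENNReal.ofReal (2 ^ σ) * (weight σ (k - j) + weight σ j) := by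
  rw [weight, weight, weight, ← ENNReal.ofReal_add (Real.rpow_nonneg (bracket_pos _).le _)
    (Real.rpow_nonneg (bracket_pos _).le _), ← ENNReal.ofReal_mul (by positivity)]
  refine ENNReal.ofReal_le_ofReal ?_
  have h1 : bracket k ≤ 2 * max (bracket (k - j)) (bracket j) := by
    linarith [bracket_le_add k j, le_max_left (bracket (k - j)) (bracket j),
      le_max_right (bracket (k - j)) (bracket j)]
  have h2 := Real.rpow_le_rpow (bracket_pos k).le h1 hσ
  rw [Real.mul_rpow zero_le_two ((bracket_pos j).le.trans (le_max_right _ _))] at h2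
  refine h2.trans (mul_le_mul_of_nonneg_left ?_ (by positivity))
  have h3 := Real.rpow_nonneg (bracket_pos (k - j)).le σ
  have h4 := Real.rpow_nonneg (bracket_pos j).le σ
  rcases max_choice (bracket (k - j)) (bracket j) with h | h <;> rw [h] <;> linarith

/-- The norm `‖⟨k⟩^σ a(k)‖_{ℓ²}`, possibly infinite. -/
noncomputable def weightedNorm (σ : ℝ) (a : ℤ → ℂ) : ℝ≥0∞ := l2Norm fun k => weight σ k * ‖a k‖ₑ

theorem weightedNorm_mono {σ τ : ℝ} (h : σ ≤ τ) (a : ℤ → ℂ) :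
    weightedNorm σ a ≤ weightedNorm τ a :=
  l2Norm_mono fun k => mul_le_mul_left (weight_mono h k) _

theorem weightedNorm_add_le (σ : ℝ) (a b : ℤ → ℂ) :
    weightedNorm σ (fun k => a k + b k) ≤ weightedNorm σ a + weightedNorm σ b := by
  refine le_trans (l2Norm_mono fun k => ?_) (l2Norm_add_le _ _)
  rw [← mul_add]
  exact mul_le_mul_right (enorm_add_le _ _) _

theorem weightedNorm_sub_le (σ : ℝ) (a b : ℤ → ℂ) :
    weightedNorm σ (fun k => a k - b k) ≤ weightedNorm σ a + weightedNorm σ b := by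
  refine le_trans (l2Norm_mono fun k => ?_) (l2Norm_add_le _ _)
  rw [← mul_add]
  exact mul_le_mul_right enorm_sub_le _

/-- Discrete convolution. -/
noncomputable def convolution (a b : ℤ → ℂ) (k : ℤ) : ℂ := ∑' j, a (k - j) * b j

/-- The Fourier coefficients of the mean-zero primitive of a product. -/
noncomputable def primitiveMul (a b : ℤ → ℂ) (k : ℤ) : ℂ := convolution a b k / (Complex.I * k)

/-- The weight is split by ⟨k⟩^σ ≤ 2^σ(⟨k-j⟩^σ + ⟨j⟩^σ), and Cauchy–Schwarz is applied to each sum.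
The bound is uniform in k, reflecting that L² · L² ⊂ L¹ has bounded coefficients. -/
theorem weight_mul_enorm_convolution_le {σ : ℝ} (hσ : 0 ≤ σ) (a b : ℤ → ℂ) (k : ℤ) :
    weight σ k * ‖convolution a b k‖ₑ ≤
      2 * ENNReal.ofReal (2 ^ σ) * (weightedNorm σ a * weightedNorm σ b) := by
  have h0 (a : ℤ → ℂ) : l2Norm (fun k => ‖a k‖ₑ) ≤ weightedNorm σ a := by
    refine l2Norm_mono fun k => ?_
    calc ‖a k‖ₑ = weight 0 k * ‖a k‖ₑ := by rw [weight_zero, one_mul]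
      _ ≤ _ := mul_le_mul_left (weight_mono hσ k) _
  calc weight σ k * ‖convolution a b k‖ₑ
      ≤ weight σ k * ∑' j, ‖a (k - j)‖ₑ * ‖b j‖ₑ := by
        refine mul_le_mul_right ?_ _
        refine (enorm_tsum_le_tsum_enorm).trans (le_of_eq ?_)
        simp only [enorm_mul]
    _ = ∑' j, weight σ k * (‖a (k - j)‖ₑ * ‖b j‖ₑ) := ENNReal.tsum_mul_left.symm
    _ ≤ ∑' j, ENNReal.ofReal (2 ^ σ) * ((weight σ (k - j) * ‖a (k - j)‖ₑ) * ‖b j‖ₑ +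
          ‖a (k - j)‖ₑ * (weight σ j * ‖b j‖ₑ)) := by
        refine ENNReal.tsum_le_tsum fun j => ?_
        refine (mul_le_mul_left (weight_le_add hσ k j) _).trans (le_of_eq ?_)
        ring
    _ = ENNReal.ofReal (2 ^ σ) * (∑' j, (weight σ (k - j) * ‖a (k - j)‖ₑ) * ‖b j‖ₑ +
          ∑' j, ‖a (k - j)‖ₑ * (weight σ j * ‖b j‖ₑ)) := by
        rw [ENNReal.tsum_mul_left, ENNReal.tsum_add]
    _ ≤ ENNReal.ofReal (2 ^ σ) * (weightedNorm σ a * weightedNorm σ b +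
          weightedNorm σ a * weightedNorm σ b) := by
        refine mul_le_mul_right (add_le_add ?_ ?_) _
        · exact (tsum_convolution_le (fun k => weight σ k * ‖a k‖ₑ) (fun k => ‖b k‖ₑ) k).trans
            (mul_le_mul_right (h0 b) _)
        · exact (tsum_convolution_le (fun k => ‖a k‖ₑ) (fun k => weight σ k * ‖b k‖ₑ) k).trans
            (mul_le_mul_left (h0 a) _)
    _ = _ := by ring

/-- The squared terms are at most 2|k|^{-3/2}, so the sum converges; the term k = 0 vanishes because
`0⁻¹ = 0`. -/
theorem l2Norm_smoothing_lt_top :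
    l2Norm (fun k : ℤ => weight (1 / 4) k * ‖(Complex.I * k)⁻¹‖ₑ) < ∞ := by
  have hle (k : ℤ) : (weight (1 / 4) k * ‖(Complex.I * k)⁻¹‖ₑ) ^ (2 : ℝ) ≤
      ENNReal.ofReal (2 * |(k : ℝ)| ^ (-(3 / 2) : ℝ)) := by
    rw [← ofReal_norm, weight, ← ENNReal.ofReal_mul (Real.rpow_nonneg (bracket_pos k).le _),
      ENNReal.ofReal_rpow_of_nonneg (mul_nonneg (Real.rpow_nonneg (bracket_pos k).le _)
        (norm_nonneg _)) zero_le_two]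
    refine ENNReal.ofReal_le_ofReal ?_
    by_cases hk : k = 0
    · simp [hk]
    have hk' : (0 : ℝ) < |(k : ℝ)| := abs_pos.2 (by exact_mod_cast hk)
    have h1 : ‖(Complex.I * k)⁻¹‖ = |(k : ℝ)| ^ (-1 : ℝ) := by
      rw [norm_inv, norm_mul, Complex.norm_I, one_mul, Complex.norm_intCast, Real.rpow_neg_one]
    rw [h1, Real.mul_rpow (Real.rpow_nonneg (bracket_pos k).le _) (by positivity),
      ← Real.rpow_mul (bracket_pos k).le, ← Real.rpow_mul hk'.le]
    have h2 : bracket k ^ (1 / 4 * 2 : ℝ) ≤ 2 * |(k : ℝ)| ^ (1 / 2 : ℝ) := by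
      have h3 := Real.rpow_le_rpow (bracket_pos k).le (bracket_le_two_mul_abs hk)
        (by norm_num : (0 : ℝ) ≤ 1 / 4 * 2)
      rw [Real.mul_rpow zero_le_two hk'.le] at h3
      have h4 : (2 : ℝ) ^ (1 / 4 * 2 : ℝ) ≤ 2 := by
        calc (2 : ℝ) ^ (1 / 4 * 2 : ℝ) ≤ 2 ^ (1 : ℝ) :=
              Real.rpow_le_rpow_of_exponent_le one_le_two (by norm_num)
          _ = 2 := Real.rpow_one 2
      refine h3.trans ?_
      rw [show (1 / 4 * 2 : ℝ) = 1 / 2 by norm_num] at h4 ⊢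
      exact mul_le_mul_of_nonneg_right h4 (by positivity)
    calc _ ≤ 2 * |(k : ℝ)| ^ (1 / 2 : ℝ) * |(k : ℝ)| ^ (-1 * 2 : ℝ) :=
          mul_le_mul_of_nonneg_right h2 (by positivity)
      _ = _ := by rw [mul_assoc, ← Real.rpow_add hk']; norm_num
  refine ENNReal.rpow_lt_top_of_nonneg (by norm_num) (ne_of_lt ?_)
  refine (ENNReal.tsum_le_tsum hle).trans_lt ?_
  exact ((Real.summable_abs_int_rpow (by norm_num : (1 : ℝ) < 3 / 2)).mul_left 2).tsum_ofReal_lt_top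

/-- The mean-zero primitive of a product gains a quarter of a derivative. -/
theorem exists_weightedNorm_primitiveMul_le {σ : ℝ} (hσ : 0 ≤ σ) :
    ∃ C : ℝ≥0∞, C ≠ ∞ ∧ ∀ a b : ℤ → ℂ,
      weightedNorm (σ + 1 / 4) (primitiveMul a b) ≤ C * (weightedNorm σ a * weightedNorm σ b) := by
  refine ⟨l2Norm (fun k : ℤ => weight (1 / 4) k * ‖(Complex.I * k)⁻¹‖ₑ) *
    (2 * ENNReal.ofReal (2 ^ σ)), ?_, fun a b => ?_⟩
  · exact ENNReal.mul_ne_top l2Norm_smoothing_lt_top.ne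
      (ENNReal.mul_ne_top ENNReal.ofNat_ne_top ENNReal.ofReal_ne_top)
  · refine (l2Norm_mono (g := fun k => (2 * ENNReal.ofReal (2 ^ σ) *
      (weightedNorm σ a * weightedNorm σ b)) * (weight (1 / 4) k * ‖(Complex.I * k)⁻¹‖ₑ))
      fun k => ?_).trans (le_of_eq ?_)
    · rw [weight_add, primitiveMul, div_eq_mul_inv (convolution a b k), enorm_mul]
      calc _ = (weight σ k * ‖convolution a b k‖ₑ) * (weight (1 / 4) k * ‖(Complex.I * k)⁻¹‖ₑ) := by
            ring
        _ ≤ _ := mul_le_mul_left (weight_mul_enorm_convolution_le hσ a b k) _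
    · rw [l2Norm_const_mul]; ring

end WeightedNorms
end Miura

namespace Miura
open scoped ENNReal

/-! ### The Hilbert space of coefficients and the bilinear map -/

section SequenceSpace

theorem weightedNorm_zero_eq (a : ℤ → ℂ) :
    weightedNorm 0 a = (∑' k, ‖a k‖ₑ ^ (2 : ℝ)) ^ (1 / 2 : ℝ) := by
  simp [weightedNorm, l2Norm, weight_zero]

theorem memℓp_two_of_weightedNorm_ne_top {a : ℤ → ℂ} (h : weightedNorm 0 a ≠ ∞) : Memℓp a 2 := by
  refine memℓp_gen ?_
  rw [weightedNorm_zero_eq] at h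
  have h1 : ∑' k, ‖a k‖ₑ ^ (2 : ℝ) ≠ ∞ := fun h2 => h (by rw [h2]; simp)
  have h2 := ENNReal.summable_toReal h1
  refine h2.congr fun k => ?_
  rw [← ENNReal.toReal_rpow, toReal_enorm, ENNReal.toReal_ofNat]

theorem weightedNorm_zero_lp (a : lp (fun _ : ℤ => ℂ) 2) : weightedNorm 0 a = ‖a‖ₑ := by
  have hs := lp.hasSum_norm (p := 2) (by norm_num) a
  rw [ENNReal.toReal_ofNat] at hs
  rw [weightedNorm_zero_eq, ← ofReal_norm]
  have h1 : ∑' k, ‖a k‖ₑ ^ (2 : ℝ) = ENNReal.ofReal (‖a‖ ^ (2 : ℝ)) := by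
    rw [← hs.tsum_eq, ENNReal.ofReal_tsum_of_nonneg (fun k => by positivity) hs.summable]
    congr 1
    ext k
    rw [← ofReal_norm, ENNReal.ofReal_rpow_of_nonneg (norm_nonneg _) zero_le_two]
  rw [h1, ← ENNReal.ofReal_rpow_of_nonneg (norm_nonneg _) zero_le_two, ← ENNReal.rpow_mul]
  norm_num

/-- Square-summable sequences of Fourier coefficients of real mean-zero functions. -/
def RealSeq : Submodule ℝ (lp (fun _ : ℤ => ℂ) 2) where
  carrier := {a | a 0 = 0 ∧ ∀ k, a (-k) = starRingEnd ℂ (a k)}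
  add_mem' ha hb := ⟨by simp [ha.1, hb.1], fun k => by simp [ha.2 k, hb.2 k]⟩
  zero_mem' := ⟨rfl, fun k => by simp⟩
  smul_mem' c a ha := ⟨by simp [ha.1], fun k => by simp [ha.2 k]⟩

theorem isClosed_realSeq : IsClosed (RealSeq : Set (lp (fun _ : ℤ => ℂ) 2)) := by
  have h (k : ℤ) : Continuous fun a : lp (fun _ : ℤ => ℂ) 2 => a k :=
    (lp.lipschitzWith_one_eval 2 k).continuous
  have : (RealSeq : Set (lp (fun _ : ℤ => ℂ) 2)) =
      {a | a 0 = 0} ∩ ⋂ k : ℤ, {a | a (-k) = starRingEnd ℂ (a k)} := by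
    ext a; simp [RealSeq]
  rw [this]
  exact (isClosed_eq (h 0) continuous_const).inter
    (isClosed_iInter fun k => isClosed_eq (h _) (Complex.continuous_conj.comp (h k)))

instance : CompleteSpace RealSeq := isClosed_realSeq.completeSpace_coe

theorem RealSeq.ext {a b : RealSeq} (h : ∀ k, a.1 k = b.1 k) : a = b :=
  Subtype.ext (lp.ext (funext h))

theorem RealSeq.weightedNorm_zero (a : RealSeq) : weightedNorm 0 a.1 = ‖a‖ₑ :=
  weightedNorm_zero_lp a.1

theorem summable_convolution (a b : lp (fun _ : ℤ => ℂ) 2) (k : ℤ) :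
    Summable fun j => a (k - j) * b j := by
  refine Summable.of_enorm (ne_of_lt ?_)
  simp only [enorm_mul]
  refine (tsum_convolution_le (fun k => ‖a k‖ₑ) (fun k => ‖b k‖ₑ) k).trans_lt ?_
  have h (a : lp (fun _ : ℤ => ℂ) 2) : l2Norm (fun k => ‖a k‖ₑ) < ∞ := by
    have := weightedNorm_zero_lp a
    simp only [weightedNorm, weight_zero, one_mul] at this
    rw [this]; exact enorm_lt_top
  exact ENNReal.mul_lt_top (h a) (h b)

theorem convolution_comm (a b : ℤ → ℂ) (k : ℤ) : convolution a b k = convolution b a k := by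
  rw [convolution, convolution, ← (Equiv.subLeft k).tsum_eq]
  congr 1
  ext j
  simp [mul_comm]

theorem convolution_neg {a b : ℤ → ℂ} (ha : ∀ k, a (-k) = starRingEnd ℂ (a k))
    (hb : ∀ k, b (-k) = starRingEnd ℂ (b k)) (k : ℤ) :
    convolution a b (-k) = starRingEnd ℂ (convolution a b k) := by
  rw [convolution, convolution, Complex.conj_tsum, ← (Equiv.neg ℤ).tsum_eq]
  congr 1
  ext j
  rw [map_mul, ← ha, ← hb]
  simp only [Equiv.neg_apply]
  congr 2; ring

theorem memℓp_primitiveMul (a b : lp (fun _ : ℤ => ℂ) 2) : Memℓp (primitiveMul a b) 2 := by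
  obtain ⟨C, hC, h⟩ := exists_weightedNorm_primitiveMul_le le_rfl
  refine memℓp_two_of_weightedNorm_ne_top (ne_of_lt ?_)
  refine ((weightedNorm_mono (by norm_num) _).trans (h a b)).trans_lt ?_
  rw [weightedNorm_zero_lp, weightedNorm_zero_lp]
  exact ENNReal.mul_lt_top hC.lt_top (ENNReal.mul_lt_top enorm_lt_top enorm_lt_top)

/-- `primitiveMul` on `RealSeq`. -/
noncomputable def RealSeq.mul (a b : RealSeq) : RealSeq :=
  ⟨⟨primitiveMul a.1 b.1, memℓp_primitiveMul a.1 b.1⟩, by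
    refine ⟨?_, fun k => ?_⟩
    · change primitiveMul a.1 b.1 0 = 0
      -- Division by zero at k = 0 removes the mean of the product and makes the primitive
      -- mean-zero.
      simp [primitiveMul]
    · change primitiveMul a.1 b.1 (-k) = starRingEnd ℂ (primitiveMul a.1 b.1 k)
      simp [primitiveMul, convolution_neg a.2.2 b.2.2, map_div₀]⟩

theorem RealSeq.mul_apply (a b : RealSeq) (k : ℤ) :
    (RealSeq.mul a b).1 k = convolution a.1 b.1 k / (Complex.I * k) := rfl

theorem RealSeq.mul_comm (a b : RealSeq) : RealSeq.mul a b = RealSeq.mul b a :=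
  RealSeq.ext fun k => by rw [RealSeq.mul_apply, RealSeq.mul_apply, convolution_comm]

theorem RealSeq.add_mul (a a' b : RealSeq) :
    RealSeq.mul (a + a') b = RealSeq.mul a b + RealSeq.mul a' b := by
  refine RealSeq.ext fun k => ?_
  have h : convolution (a + a').1 b.1 k = convolution a.1 b.1 k + convolution a'.1 b.1 k := by
    rw [convolution, convolution, convolution,
      ← (summable_convolution a.1 b.1 k).tsum_add (summable_convolution a'.1 b.1 k)]
    congr 1
    ext j
    exact _root_.add_mul _ _ _
  rw [RealSeq.mul_apply, h, add_div]
  rfl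

theorem RealSeq.smul_mul (c : ℝ) (a b : RealSeq) :
    RealSeq.mul (c • a) b = c • RealSeq.mul a b := by
  refine RealSeq.ext fun k => ?_
  have h : convolution (c • a).1 b.1 k = c * convolution a.1 b.1 k := by
    rw [convolution, convolution, ← tsum_mul_left]
    congr 1
    ext j
    exact mul_assoc _ _ _
  rw [RealSeq.mul_apply, h, mul_div_assoc]
  rfl

theorem exists_norm_mul_le : ∃ C : ℝ, ∀ a b : RealSeq, ‖RealSeq.mul a b‖ ≤ C * ‖a‖ * ‖b‖ := by
  obtain ⟨C, hC, h⟩ := exists_weightedNorm_primitiveMul_le le_rfl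
  refine ⟨C.toReal, fun a b => ?_⟩
  have h1 : ‖RealSeq.mul a b‖ₑ ≤ C * (‖a‖ₑ * ‖b‖ₑ) := by
    rw [← RealSeq.weightedNorm_zero, ← RealSeq.weightedNorm_zero, ← RealSeq.weightedNorm_zero]
    exact (weightedNorm_mono (by norm_num) _).trans (h a.1 b.1)
  have h2 := ENNReal.toReal_mono
    (ENNReal.mul_ne_top hC (ENNReal.mul_ne_top enorm_ne_top enorm_ne_top)) h1
  rwa [ENNReal.toReal_mul, ENNReal.toReal_mul, toReal_enorm, toReal_enorm, toReal_enorm,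
    ← mul_assoc] at h2

/-- The bounded bilinear map `(v, w) ↦ ∂⁻¹(v w - P₀(v w))` on the Fourier side. -/
noncomputable def bilin : RealSeq →L[ℝ] RealSeq →L[ℝ] RealSeq :=
  LinearMap.mkContinuous₂
    (LinearMap.mk₂ ℝ RealSeq.mul RealSeq.add_mul RealSeq.smul_mul
      (fun a b b' => by
        rw [RealSeq.mul_comm, RealSeq.add_mul, RealSeq.mul_comm b, RealSeq.mul_comm b'])
      (fun c a b => by rw [RealSeq.mul_comm, RealSeq.smul_mul, RealSeq.mul_comm b]))
    exists_norm_mul_le.choose exists_norm_mul_le.choose_spec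

theorem bilin_apply (a b : RealSeq) : bilin a b = RealSeq.mul a b := rfl

theorem bilin_comm (a b : RealSeq) : bilin a b = bilin b a := RealSeq.mul_comm a b

end SequenceSpace
end Miura

namespace Miura
open MeasureTheory Real

/-! ### Extension of the L² estimates from continuous functions -/

section Density

theorem RealSeq.hasSum_norm_sq (a : RealSeq) : HasSum (fun k => ‖a.1 k‖ ^ 2) (‖a‖ ^ 2) := by
  have hs := lp.hasSum_norm (p := 2) (by norm_num) a.1
  rw [ENNReal.toReal_ofNat] at hs
  simpa using hs

theorem RealSeq.norm_sq_eq {a : RealSeq} {f : ℝ → ℝ} (hf : MemLp f 2 periodMeasure)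
    (h : coef (fun x => f x) = a.1) : ‖a‖ ^ 2 = 1 / (2 * π) * ∫ x in Set.Ioc 0 (2 * π), f x ^ 2 := by
  have h1 := integral_sq_eq hf
  rw [h] at h1
  exact (RealSeq.hasSum_norm_sq a).unique h1

theorem coef_sub {f g : ℝ → ℝ} (hf : MemLp f 2 periodMeasure) (hg : MemLp g 2 periodMeasure)
    (k : ℤ) : coef (fun x => ((f x - g x : ℝ) : ℂ)) k = coef (fun x => f x) k - coef (fun x => g x) k := by
  rw [coef, coef, coef, ← mul_sub, ← integral_sub]
  · congr 2; ext x; push_cast; ring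
  · exact (exp_neg_mul_memLp (hf.ofReal (K := ℂ)) k).integrable (by norm_num)
  · exact (exp_neg_mul_memLp (hg.ofReal (K := ℂ)) k).integrable (by norm_num)

theorem coef_const (c : ℂ) (k : ℤ) : coef (fun _ => c) k = if k = 0 then c else 0 := by
  rw [coef, integral_const_mul, integral_exp_neg_int_mul]
  split_ifs with hk
  · have : (π : ℂ) ≠ 0 := by exact_mod_cast pi_ne_zero
    push_cast
    field_simp
  · simp

theorem coef_zero_eq (f : ℝ → ℝ) :
    coef (fun x => f x) 0 = ((1 / (2 * π) * ∫ x in (0 : ℝ)..2 * π, f x : ℝ) : ℂ) := by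
  rw [coef, intervalIntegral.integral_of_le two_pi_pos.le]
  push_cast
  rw [← integral_complex_ofReal]
  simp

theorem memLp_periodMeasure_of_continuous {f : ℝ → ℝ} (hf : Continuous f) : MemLp f 2 periodMeasure := by
  obtain ⟨C, hC⟩ := isCompact_Icc.exists_bound_of_continuousOn (s := Set.Icc 0 (2 * π))
    hf.continuousOn
  refine MemLp.of_bound hf.aestronglyMeasurable C ?_
  filter_upwards [ae_restrict_mem measurableSet_Ioc] with x hx
  exact hC x (Set.Ioc_subset_Icc_self hx)

/-- The Fourier coefficients of the mean-zero part of a real square-integrable function. -/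
theorem exists_realSeq_coef {f : ℝ → ℝ} (hf : MemLp f 2 periodMeasure) :
    ∃ a : RealSeq, ∀ k, k ≠ 0 → a.1 k = coef (fun x => f x) k := by
  have hs := (integral_sq_eq hf).summable
  refine ⟨⟨⟨fun k => if k = 0 then 0 else coef (fun x => f x) k, ?_⟩, ?_, ?_⟩, ?_⟩
  · refine memℓp_gen ?_
    refine Summable.of_nonneg_of_le (fun k => by positivity) (fun k => ?_) hs
    rw [ENNReal.toReal_ofNat, rpow_two]
    by_cases hk : k = 0
    · simp [hk]
    · simp [hk]
  · simp
  · intro k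
    by_cases hk : k = 0
    · simp [hk]
    · simp only [hk, neg_eq_zero, if_false]
      exact coef_ofReal_neg f k
  · intro k hk
    simp [hk]

/-- Sequences of Fourier coefficients of continuous functions. -/
def IsCoefOfContinuous (a : RealSeq) : Prop := ∃ f : ℝ → ℝ, Continuous f ∧ coef (fun x => f x) = a.1

/-- Continuous functions are dense in L² of the period, and subtracting a mean only helps. No
periodicity of the representing function is asked for: in the estimates only the primitives must
match at the endpoints. -/
theorem dense_isCoefOfContinuous : Dense {a | IsCoefOfContinuous a} := by
  intro a
  refine Metric.mem_closure_iff.2 fun ε hε => ?_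
  obtain ⟨f, hf, hfa⟩ := exists_memLp_coef_eq a.1 a.2.2
  obtain ⟨g, hg, hgm⟩ := MemLp.exists_boundedContinuous_integral_rpow_sub_le (p := 2) (by norm_num)
    (by simpa using hf) (ε := ε ^ 2) (by positivity)
  have hgm : MemLp g 2 periodMeasure := by simpa using hgm
  obtain ⟨b, hb⟩ := exists_realSeq_coef hgm
  let m : ℝ := 1 / (2 * π) * ∫ x in (0 : ℝ)..2 * π, g x
  refine ⟨b, ⟨fun x => g x - m, by fun_prop, funext fun k => ?_⟩, ?_⟩
  · rw [coef_sub hgm (memLp_const m), coef_const]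
    by_cases hk : k = 0
    · rw [if_pos hk, hk, b.2.1, coef_zero_eq, sub_self]
    · rw [if_neg hk, hb k hk, sub_zero]
  · have h1 := RealSeq.hasSum_norm_sq (a - b)
    have h2 := integral_sq_eq (hf.sub hgm)
    -- Termwise comparison in Parseval: replacing g by g - m only discards the zeroth term. The
    -- factor 1/(2π) < 1 later yields strict inequality.
    have h3 : ‖a - b‖ ^ 2 ≤ 1 / (2 * π) * ∫ x in Set.Ioc 0 (2 * π), (f x - g x) ^ 2 := by
      refine hasSum_le (fun k => ?_) h1 h2
      by_cases hk : k = 0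
      · have : (a - b).1 k = 0 := by rw [hk]; exact (a - b).2.1
        rw [this]; simp
      · have : (a - b).1 k = coef (fun x => ((f x - g x : ℝ) : ℂ)) k := by
          rw [coef_sub hf hgm, hfa, ← hb k hk]; rfl
        rw [this]; rfl
    have h4 : ∫ x in Set.Ioc 0 (2 * π), (f x - g x) ^ 2 ≤ ε ^ 2 := by
      refine le_trans (le_of_eq ?_) hg
      congr 1; ext x; simp
    have h5 : 1 / (2 * π) < 1 := by
      rw [div_lt_one two_pi_pos]; linarith [pi_gt_three]
    rw [dist_eq_norm]
    refine lt_of_pow_lt_pow_left₀ 2 hε.le (h3.trans_lt ?_)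
    have h6 : 0 < 1 / (2 * π) := by have := two_pi_pos; positivity
    nlinarith [sq_nonneg ε, pow_pos hε 2]

/-- For continuous functions, `bilin` is the mean-zero primitive of the product. -/
theorem exists_primitive_bilin {a b : RealSeq} {f g : ℝ → ℝ} (hf : Continuous f) (hg : Continuous g)
    (hfa : coef (fun x => f x) = a.1) (hgb : coef (fun x => g x) = b.1) :
    ∃ e : ℝ → ℝ, (∀ x, HasDerivAt e (f x * g x - 1 / (2 * π) * ∫ x in (0 : ℝ)..2 * π, f x * g x) x) ∧
      e (2 * π) = e 0 ∧ ∫ x in (0 : ℝ)..2 * π, e x = 0 ∧ coef (fun x => e x) = (bilin a b).1 := by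
  set c := 1 / (2 * π) * ∫ x in (0 : ℝ)..2 * π, f x * g x with hc
  have hπ := two_pi_pos
  have hcont : Continuous fun x => f x * g x - c := by fun_prop
  let e₀ : ℝ → ℝ := fun x => ∫ t in (0 : ℝ)..x, (f t * g t - c)
  have he₀ (x) : HasDerivAt e₀ (f x * g x - c) x := hasDerivAt_primitive hcont x
  have he₀c : Continuous e₀ := continuous_iff_continuousAt.2 fun x => (he₀ x).continuousAt
  let m := 1 / (2 * π) * ∫ x in (0 : ℝ)..2 * π, e₀ x
  have he (x) : HasDerivAt (fun x => e₀ x - m) (f x * g x - c) x := (he₀ x).sub_const m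
  have hend : e₀ (2 * π) - m = e₀ 0 - m := by
    simp only [e₀]
    rw [intervalIntegral.integral_sub (by apply Continuous.intervalIntegrable; fun_prop) (by simp)]
    simp only [intervalIntegral.integral_const, intervalIntegral.integral_same, smul_eq_mul, hc]
    field_simp
    ring
  have hmean : ∫ x in (0 : ℝ)..2 * π, (e₀ x - m) = 0 := by
    rw [intervalIntegral.integral_sub (he₀c.intervalIntegrable _ _) (by simp)]
    simp only [intervalIntegral.integral_const, smul_eq_mul, m]
    field_simp
    ring
  refine ⟨fun x => e₀ x - m, he, hend, hmean, funext fun k => ?_⟩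
  by_cases hk : k = 0
  · rw [hk, (bilin a b).2.1, coef_zero_eq, hmean]
    simp
  · have hk' : Complex.I * k ≠ 0 := by simp [hk]
    rw [bilin_apply, RealSeq.mul_apply, eq_div_iff hk', _root_.mul_comm _ (Complex.I * (k : ℂ))]
    have h1 := coef_of_hasDerivAt (e := fun x => ((e₀ x - m : ℝ) : ℂ))
      (e' := fun x => ((f x * g x - c : ℝ) : ℂ)) (fun x => (he x).ofReal_comp)
      (by fun_prop) (by simp only [hend]) k
    rw [← h1, coef_sub (memLp_periodMeasure_of_continuous (by fun_prop)) (memLp_const c), coef_const,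
      if_neg hk, sub_zero, ← (hasSum_coef_mul (memLp_periodMeasure_of_continuous hf)
        (memLp_periodMeasure_of_continuous hg) k).tsum_eq, hfa, hgb]
    rfl

theorem integral_sq_eq_norm_sq {a : RealSeq} {f : ℝ → ℝ} (hf : Continuous f)
    (h : coef (fun x => f x) = a.1) : ∫ x in (0 : ℝ)..2 * π, f x ^ 2 = 2 * π * ‖a‖ ^ 2 := by
  rw [RealSeq.norm_sq_eq (memLp_periodMeasure_of_continuous hf) h,
    intervalIntegral.integral_of_le two_pi_pos.le]
  have := two_pi_pos
  field_simp

theorem integral_eq_zero_of_coef {a : RealSeq} {f : ℝ → ℝ}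
    (h : coef (fun x => f x) = a.1) : ∫ x in (0 : ℝ)..2 * π, f x = 0 := by
  have h1 := coef_zero_eq f
  rw [h, a.2.1] at h1
  have h2 := Complex.ofReal_eq_zero.1 h1.symm
  simpa [pi_ne_zero] using h2

theorem coef_add_eq {a b : RealSeq} {f g : ℝ → ℝ} (hf : Continuous f) (hg : Continuous g)
    (hfa : coef (fun x => f x) = a.1) (hgb : coef (fun x => g x) = b.1) :
    coef (fun x => ((f x + g x : ℝ) : ℂ)) = (a + b).1 := by
  ext k
  have h := coef_sub (f := f) (g := fun x => -g x) (memLp_periodMeasure_of_continuous hf)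
    (memLp_periodMeasure_of_continuous hg.neg) k
  have h' := coef_sub (f := fun _ => 0) (g := g) (memLp_const 0)
    (memLp_periodMeasure_of_continuous hg) k
  simp only [sub_neg_eq_add, zero_sub] at h h'
  rw [h, h', Complex.ofReal_zero, coef_const, ite_self, zero_sub, sub_neg_eq_add, hfa, hgb]
  rfl

/-- The constant in the bound for the linearized map. -/
noncomputable def linConst (r : ℝ) : ℝ :=
  2 + 16 * π * exp (8 * √(2 * π * (2 * π * r ^ 2))) * (2 * π * r ^ 2)

theorem norm_sq_le_linearized_of_continuous {a d : RealSeq} (ha : IsCoefOfContinuous a)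
    (hd : IsCoefOfContinuous d) : ‖d‖ ^ 2 ≤ linConst ‖a‖ * ‖d + bilin a d‖ ^ 2 := by
  obtain ⟨f, hf, hfa⟩ := ha
  obtain ⟨g, hg, hgd⟩ := hd
  obtain ⟨e, he, hend, hmean, hebil⟩ := exists_primitive_bilin hf hg hfa hgd
  have hec : Continuous e := continuous_iff_continuousAt.2 fun x => (he x).continuousAt
  have h := integral_sq_le_of_linearized hf hg he hend (integral_eq_zero_of_coef hfa) hmean
    (integral_sq_eq_norm_sq hf hfa).le
  rw [integral_sq_eq_norm_sq hg hgd, integral_sq_eq_norm_sq (f := fun x => g x + e x)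
    (hg.add hec) (coef_add_eq hg hec hgd hebil)] at h
  refine le_of_mul_le_mul_left (a := 2 * π) ?_ two_pi_pos
  refine h.trans (le_of_eq ?_)
  rw [linConst]; ring

theorem continuous_linConst : Continuous linConst := by
  unfold linConst
  fun_prop

/-- Both sides are continuous, so the inequality is closed in each variable; density is used first
in `d`, then in `a`. -/
theorem norm_sq_le_linearized (a d : RealSeq) :
    ‖d‖ ^ 2 ≤ linConst ‖a‖ * ‖d + bilin a d‖ ^ 2 := by
  have hd (a : RealSeq) (ha : IsCoefOfContinuous a) (d : RealSeq) :
      ‖d‖ ^ 2 ≤ linConst ‖a‖ * ‖d + bilin a d‖ ^ 2 := by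
    have hclosed : IsClosed {d : RealSeq | ‖d‖ ^ 2 ≤ linConst ‖a‖ * ‖d + bilin a d‖ ^ 2} :=
      isClosed_le (by fun_prop) (by fun_prop)
    exact closure_minimal (fun d hd => norm_sq_le_linearized_of_continuous ha hd) hclosed
      (dense_isCoefOfContinuous d)
  have hclosed : IsClosed {a : RealSeq | ‖d‖ ^ 2 ≤ linConst ‖a‖ * ‖d + bilin a d‖ ^ 2} := by
    refine isClosed_le continuous_const ((continuous_linConst.comp continuous_norm).mul ?_)
    fun_prop
  exact closure_minimal (fun a ha => hd a ha d) hclosed (dense_isCoefOfContinuous a)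

theorem norm_le_linearized (R : ℝ) :
    ∃ C : ℝ, ∀ a d : RealSeq, ‖a‖ ≤ R → ‖d‖ ≤ C * ‖d + bilin a d‖ := by
  refine ⟨√(linConst R), fun a d ha => ?_⟩
  have h1 : linConst ‖a‖ ≤ linConst R := by
    unfold linConst; gcongr
  have h2 : 0 ≤ linConst R := by unfold linConst; positivity
  refine abs_le_of_sq_le_sq' ?_ (by positivity) |>.2
  rw [mul_pow, sq_sqrt h2]
  exact (norm_sq_le_linearized a d).trans (mul_le_mul_of_nonneg_right h1 (sq_nonneg _))

/-- By Parseval the constant m in `mean_sq_le`, the mean of v², is exactly ‖v‖². -/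
theorem norm_sq_le_quadratic (v : RealSeq) :
    ‖v‖ ^ 2 ≤ 2 * (2 * π * ‖v + bilin v v‖ ^ 2) * (5 + 4 * (2 * π * ‖v + bilin v v‖ ^ 2)) := by
  have hclosed : IsClosed {v : RealSeq |
      ‖v‖ ^ 2 ≤ 2 * (2 * π * ‖v + bilin v v‖ ^ 2) * (5 + 4 * (2 * π * ‖v + bilin v v‖ ^ 2))} :=
    isClosed_le (by fun_prop) (by fun_prop)
  have hsub : {a | IsCoefOfContinuous a} ⊆ {v : RealSeq |
      ‖v‖ ^ 2 ≤ 2 * (2 * π * ‖v + bilin v v‖ ^ 2) * (5 + 4 * (2 * π * ‖v + bilin v v‖ ^ 2))} := by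
    rintro v ⟨f, hf, hfv⟩
    obtain ⟨w, hw, hend, hmean, hwbil⟩ := exists_primitive_bilin hf hf hfv hfv
    have hwc : Continuous w := continuous_iff_continuousAt.2 fun x => (hw x).continuousAt
    simp only [← pow_two] at hw
    have h := mean_sq_le hf hw hend (integral_eq_zero_of_coef hfv)
    rw [integral_sq_eq_norm_sq hf hfv,
      integral_sq_eq_norm_sq (f := fun x => f x + w x) (hf.add hwc) (coef_add_eq hf hwc hfv hwbil)] at h
    refine le_trans (le_of_eq ?_) h
    have hπ := two_pi_pos
    field_simp
  have := closure_minimal hsub hclosed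
  rw [dense_isCoefOfContinuous.closure_eq] at this
  exact this (Set.mem_univ v)

theorem norm_le_quadratic (R : ℝ) :
    ∃ K : ℝ, ∀ v : RealSeq, ‖v + bilin v v‖ ≤ R → ‖v‖ ≤ K := by
  refine ⟨√(2 * (2 * π * R ^ 2) * (5 + 4 * (2 * π * R ^ 2))), fun v hv => ?_⟩
  refine le_sqrt_of_sq_le ((norm_sq_le_quadratic v).trans ?_)
  gcongr

theorem realSeq_quadratic_surjective :
    Function.Surjective fun v : RealSeq => v + bilin v v :=
  quadratic_surjective bilin bilin_comm norm_le_linearized norm_le_quadratic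

end Density
end Miura

namespace Miura
open MeasureTheory Real
open scoped ENNReal

/-! ### Bootstrapping the Lipschitz estimate to order s -/

section Regularity

/-- The Miura map in integrated form, `v ↦ v + ∂⁻¹(v² - P₀(v²))`, on the Fourier side. -/
noncomputable def quadMap (v : RealSeq) : RealSeq := v + bilin v v

theorem quadMap_zero : quadMap 0 = 0 := by simp [quadMap]

theorem quadMap_sub (v w : RealSeq) :
    quadMap v - quadMap w = (v - w) + bilin (v + w) (v - w) :=
  quadratic_sub bilin bilin_comm v w

/-- `quadMap` has an inverse that is Lipschitz on balls, measured in the norm of order `s` on the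
right-hand side and in the norm of order `σ` on the left-hand side. -/
def LipschitzInverse (s σ : ℝ) : Prop :=
  ∀ R : ℝ≥0∞, R ≠ ∞ → ∃ L : ℝ≥0∞, L ≠ ∞ ∧ ∀ v w : RealSeq,
    weightedNorm s (quadMap v).1 ≤ R → weightedNorm s (quadMap w).1 ≤ R →
      weightedNorm σ (v - w).1 ≤ L * weightedNorm s (quadMap v - quadMap w).1

theorem lipschitzInverse_zero {s : ℝ} (hs : 0 ≤ s) : LipschitzInverse s 0 := by
  intro R hR
  obtain ⟨L, hL⟩ := quadratic_lipschitz bilin bilin_comm norm_le_linearized norm_le_quadratic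
    R.toReal
  have hle (v : RealSeq) : ‖v‖ₑ ≤ weightedNorm s v.1 := by
    rw [← RealSeq.weightedNorm_zero]
    exact weightedNorm_mono hs _
  have hnorm (v : RealSeq) (hv : weightedNorm s (quadMap v).1 ≤ R) :
      ‖v + bilin v v‖ ≤ R.toReal := by
    have := ENNReal.toReal_mono hR ((hle (quadMap v)).trans hv)
    rwa [toReal_enorm] at this
  refine ⟨ENNReal.ofReal L, ENNReal.ofReal_ne_top, fun v w hv hw => ?_⟩
  rw [RealSeq.weightedNorm_zero]
  refine le_trans ?_ (mul_le_mul_right (hle _) _)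
  rw [← ofReal_norm, ← ofReal_norm, ← ENNReal.ofReal_mul' (norm_nonneg _)]
  exact ENNReal.ofReal_le_ofReal (hL v w (hnorm v hv) (hnorm w hw))

/-- In v - w = (F(v) - F(w)) - B(v + w, v - w) the first term has order s and the second gains 1/4
over σ. Norms may be infinite, so the estimate also contains the regularity assertion that the left
side is finite. -/
theorem LipschitzInverse.gain {s σ : ℝ} (hσ : 0 ≤ σ) (h : LipschitzInverse s σ) :
    LipschitzInverse s (min (σ + 1 / 4) s) := by
  intro R hR
  obtain ⟨L, hL, hLip⟩ := h R hR
  obtain ⟨C, hC, hB⟩ := exists_weightedNorm_primitiveMul_le hσ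
  have hzero : weightedNorm s (quadMap 0).1 ≤ R := by
    rw [quadMap_zero]
    refine le_trans (le_of_eq ?_) bot_le
    simp [weightedNorm, l2Norm]
  -- Comparison with 0, which `quadMap` fixes, turns the Lipschitz bound into a bound on `v` itself.
  have hbdd (v : RealSeq) (hv : weightedNorm s (quadMap v).1 ≤ R) : weightedNorm σ v.1 ≤ L * R := by
    have := hLip v 0 hv hzero
    rw [quadMap_zero, sub_zero, sub_zero] at this
    exact this.trans (mul_le_mul_right hv _)
  refine ⟨1 + C * ((L * R + L * R) * L), ?_, fun v w hv hw => ?_⟩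
  · finiteness
  · set D := weightedNorm s (quadMap v - quadMap w).1
    have hd : (v - w).1 = fun k => (quadMap v - quadMap w).1 k - (bilin (v + w) (v - w)).1 k := by
      have : v - w = (quadMap v - quadMap w) - bilin (v + w) (v - w) := by
        rw [quadMap_sub]; abel
      conv_lhs => rw [this]
      rfl
    have hsum : weightedNorm σ (v + w).1 ≤ L * R + L * R :=
      (weightedNorm_add_le σ v.1 w.1).trans (add_le_add (hbdd v hv) (hbdd w hw))
    rw [hd]
    calc _ ≤ _ := weightedNorm_sub_le _ _ _
      _ ≤ D + C * (weightedNorm σ (v + w).1 * weightedNorm σ (v - w).1) := by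
          refine add_le_add (weightedNorm_mono (min_le_right _ _) _) ?_
          exact (weightedNorm_mono (min_le_left _ _) _).trans (hB _ _)
      _ ≤ D + C * ((L * R + L * R) * (L * D)) := by
          refine add_le_add_right (mul_le_mul_right ?_ _) _
          exact mul_le_mul' hsum (hLip v w hv hw)
      _ = (1 + C * ((L * R + L * R) * L)) * D := by ring

theorem lipschitzInverse_self {s : ℝ} (hs : 0 ≤ s) : LipschitzInverse s s := by
  have h (n : ℕ) : LipschitzInverse s (min (n / 4) s) := by
    induction n with
    | zero => simpa [hs] using lipschitzInverse_zero hs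
    | succ n ih =>
      have h1 := ih.gain (le_min (by positivity) hs)
      have h2 : min (min ((n : ℝ) / 4) s + 1 / 4) s = min (((n + 1 : ℕ) : ℝ) / 4) s := by
        rw [← min_add_add_right, min_assoc, min_eq_right (by linarith : s ≤ s + 1 / 4)]
        congr 1
        push_cast
        ring
      rwa [h2] at h1
  obtain ⟨n, hn⟩ := exists_nat_ge (4 * s)
  have := h n
  rwa [min_eq_right (by linarith)] at this

end Regularity

/-! ### Translation between distributions and coefficient sequences -/

section Bridge

theorem weight_mul_enorm_rpow (s : ℝ) (a : ℤ → ℂ) (k : ℤ) :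
    (weight s k * ‖a k‖ₑ) ^ (2 : ℝ) =
      ENNReal.ofReal ((√(1 + (k : ℝ) ^ 2) ^ s * ‖a k‖) ^ 2) := by
  have h : 0 ≤ bracket k ^ s := Real.rpow_nonneg (bracket_pos k).le s
  rw [weight, ← ofReal_norm, ← ENNReal.ofReal_mul h,
    ENNReal.ofReal_rpow_of_nonneg (mul_nonneg h (norm_nonneg _)) zero_le_two, rpow_two]
  rfl

theorem summable_iff_weightedNorm_ne_top (s : ℝ) (a : ℤ → ℂ) :
    Summable (fun k : ℤ => (√(1 + (k : ℝ) ^ 2) ^ s * ‖a k‖) ^ 2) ↔ weightedNorm s a ≠ ∞ := by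
  rw [weightedNorm, l2Norm]
  simp only [weight_mul_enorm_rpow]
  rw [Ne, ENNReal.rpow_eq_top_iff_of_pos (by norm_num)]
  constructor
  · exact fun h => h.tsum_ofReal_ne_top
  · intro h
    refine (ENNReal.summable_toReal h).congr fun k => ?_
    exact ENNReal.toReal_ofReal (sq_nonneg _)

/-- Finiteness matters: a divergent real `tsum` is 0, so otherwise `sobolevNorm` would say nothing.
-/
theorem sobolevNorm_eq {s : ℝ} {u : Distribution} (h : weightedNorm s (fourierCoeff u) ≠ ∞) :
    sobolevNorm s u = √(2 * π) * (weightedNorm s (fourierCoeff u)).toReal := by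
  have hs := (summable_iff_weightedNorm_ne_top s (fourierCoeff u)).2 h
  rw [sobolevNorm, weightedNorm, l2Norm]
  simp only [weight_mul_enorm_rpow]
  rw [← ENNReal.ofReal_tsum_of_nonneg (fun k => sq_nonneg _) hs, ← ENNReal.toReal_rpow,
    ENNReal.toReal_ofReal (tsum_nonneg fun k => sq_nonneg _), sqrt_eq_rpow (∑' k : ℤ, _)]

theorem mem_sobolevZero_iff {s : ℝ} {u : Distribution} :
    u ∈ SobolevZero s ↔ weightedNorm s (fourierCoeff u) ≠ ∞ ∧ fourierCoeff u 0 = 0 := by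
  rw [SobolevZero, Set.mem_ofPred_eq, summable_iff_weightedNorm_ne_top, P0_eq_zero_iff]

theorem exists_realSeq_eq_fourierCoeff {s : ℝ} (hs : 0 ≤ s) {v : Distribution}
    (hv : v ∈ SobolevZero s) : ∃ a : RealSeq, fourierCoeff v = a.1 := by
  rw [mem_sobolevZero_iff] at hv
  have h : weightedNorm 0 (fourierCoeff v) ≠ ∞ :=
    ne_top_of_le_ne_top hv.1 (weightedNorm_mono hs _)
  exact ⟨⟨⟨fourierCoeff v, memℓp_two_of_weightedNorm_ne_top h⟩, hv.2, fourierCoeff_neg v⟩, rfl⟩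

theorem exists_distribution_of_realSeq (a : RealSeq) :
    ∃ (v : Distribution) (f : ℝ → ℝ), fourierCoeff v = a.1 ∧ IsL2Rep v f := by
  obtain ⟨f, hf, hfa⟩ := exists_memLp_coef_eq a.1 a.2.2
  have hint : IntegrableOn f (Set.Ioc 0 (2 * π)) := hf.integrable (by norm_num)
  refine ⟨ofFun f hint, f, ?_, hf, fun φ => rfl⟩
  rw [← hfa]
  exact funext (fourierCoeff_ofFun hint)

/-- Riesz–Fischer supplies an L² representative, so `sq` takes its main branch; whichever
representative is chosen has the coefficients of `v`, and these determine those of the square. -/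
theorem fourierCoeff_sq {v : Distribution} {a : RealSeq} (h : fourierCoeff v = a.1) (k : ℤ) :
    fourierCoeff (sq v) k = convolution a.1 a.1 k := by
  have hex : ∃ f, IsL2Rep v f := by
    obtain ⟨w, f, hw, hf⟩ := exists_distribution_of_realSeq a
    rw [Distribution.ext_fourierCoeff (h.trans hw.symm)]
    exact ⟨f, hf⟩
  have hrep := hex.choose_spec
  have hsq : sq v = ofFun (fun x => hex.choose x ^ 2) hrep.1.integrable_sq := dif_pos hex
  rw [hsq]
  refine (fourierCoeff_ofFun _ k).trans ?_
  set f := hex.choose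
  have hfa : coef (fun x => f x) = a.1 := by
    rw [← h]
    exact funext fun k => (fourierCoeff_of_forall_eq_integral
      (hrep.1.integrable (by norm_num)) hrep.2 k).symm
  have h1 := (hasSum_coef_mul hrep.1 hrep.1 k).tsum_eq
  rw [hfa] at h1
  simp only [pow_two]
  exact h1.symm

theorem fourierCoeff_miura {v : Distribution} {a : RealSeq} (h : fourierCoeff v = a.1) (k : ℤ) :
    fourierCoeff (miura v) k = Complex.I * k * (quadMap a).1 k := by
  have hq : (quadMap a).1 k = a.1 k + convolution a.1 a.1 k / (Complex.I * k) := rfl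
  rw [miura, fourierCoeff_sub, fourierCoeff_add, fourierCoeff_dx, fourierCoeff_P0,
    fourierCoeff_sq h, fourierCoeff_sq h, h, hq]
  by_cases hk : k = 0
  · simp [hk]
  · have hk' : (k : ℂ) ≠ 0 := by exact_mod_cast hk
    rw [if_neg hk, sub_zero, mul_add, mul_div_cancel₀]
    exact mul_ne_zero Complex.I_ne_zero hk'

theorem weightedNorm_deriv_le (s : ℝ) {u b : ℤ → ℂ} (h : ∀ k : ℤ, u k = Complex.I * k * b k) :
    weightedNorm (s - 1) u ≤ weightedNorm s b := by
  refine l2Norm_mono fun k => ?_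
  rw [h, enorm_mul, ← mul_assoc]
  refine mul_le_mul_left ?_ _
  rw [← sub_add_cancel s 1, add_sub_cancel_right, weight_add]
  refine mul_le_mul_right ?_ _
  rw [weight, ← ofReal_norm, rpow_one, norm_mul, Complex.norm_I, one_mul, Complex.norm_intCast]
  exact ENNReal.ofReal_le_ofReal (abs_le_bracket k)

/-- Away from k = 0 one has ⟨k⟩ ≤ 2|k|, so differentiation loses no information on mean-zero
sequences. -/
theorem weightedNorm_le_deriv (s : ℝ) {u b : ℤ → ℂ} (h : ∀ k : ℤ, u k = Complex.I * k * b k)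
    (hb : b 0 = 0) : weightedNorm s b ≤ 2 * weightedNorm (s - 1) u := by
  rw [weightedNorm, weightedNorm, ← l2Norm_const_mul]
  refine l2Norm_mono fun k => ?_
  by_cases hk : k = 0
  · simp [hk, hb]
  rw [h, enorm_mul, ← sub_add_cancel s 1, add_sub_cancel_right, weight_add]
  have h1 : weight 1 k ≤ 2 * ‖Complex.I * k‖ₑ := by
    rw [weight, ← ofReal_norm, rpow_one, norm_mul, Complex.norm_I, one_mul, Complex.norm_intCast,
      ← ENNReal.ofReal_ofNat 2, ← ENNReal.ofReal_mul zero_le_two]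
    exact ENNReal.ofReal_le_ofReal (bracket_le_two_mul_abs hk)
  calc _ ≤ weight (s - 1) k * (2 * ‖Complex.I * k‖ₑ) * ‖b k‖ₑ :=
        mul_le_mul_left (mul_le_mul_right h1 _) _
    _ = _ := by ring

end Bridge

/-! ### Bijectivity and the Lipschitz inverse of the Miura map -/

section Main

theorem miura_mapsTo {s : ℝ} (hs : 0 ≤ s) :
    Set.MapsTo miura (SobolevZero s) (SobolevZero (s - 1)) := by
  intro v hv
  obtain ⟨a, ha⟩ := exists_realSeq_eq_fourierCoeff hs hv
  obtain ⟨C, hC, hB⟩ := exists_weightedNorm_primitiveMul_le hs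
  rw [mem_sobolevZero_iff] at hv ⊢
  refine ⟨?_, by rw [fourierCoeff_miura ha]; simp⟩
  refine ne_top_of_le_ne_top ?_ (weightedNorm_deriv_le s (fourierCoeff_miura ha))
  refine ne_top_of_le_ne_top ?_ (weightedNorm_add_le s a.1 (bilin a a).1)
  rw [ha] at hv
  refine ENNReal.add_ne_top.2 ⟨hv.1, ?_⟩
  refine ne_top_of_le_ne_top ?_ ((weightedNorm_mono (by linarith) _).trans (hB a.1 a.1))
  exact ENNReal.mul_ne_top hC (ENNReal.mul_ne_top hv.1 hv.1)

theorem quadMap_injective : Function.Injective quadMap := by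
  intro a b hab
  obtain ⟨L, hL⟩ := quadratic_lipschitz bilin bilin_comm norm_le_linearized norm_le_quadratic
    ‖quadMap a‖
  have h := hL a b le_rfl (by rw [hab]; exact le_rfl)
  change ‖a - b‖ ≤ L * ‖quadMap a - quadMap b‖ at h
  rw [hab, sub_self, norm_zero, mul_zero] at h
  exact sub_eq_zero.1 (norm_le_zero_iff.1 h)

theorem miura_injOn {s : ℝ} (hs : 0 ≤ s) : Set.InjOn miura (SobolevZero s) := by
  intro v hv w hw hvw
  obtain ⟨a, ha⟩ := exists_realSeq_eq_fourierCoeff hs hv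
  obtain ⟨b, hb⟩ := exists_realSeq_eq_fourierCoeff hs hw
  have hab : quadMap a = quadMap b := by
    refine RealSeq.ext fun k => ?_
    by_cases hk : k = 0
    · rw [hk, (quadMap a).2.1, (quadMap b).2.1]
    · have h := fourierCoeff_miura ha k
      rw [hvw, fourierCoeff_miura hb k] at h
      exact (mul_left_cancel₀ (mul_ne_zero Complex.I_ne_zero (by exact_mod_cast hk)) h).symm
  rw [quadMap_injective hab, ← hb] at ha
  exact Distribution.ext_fourierCoeff ha

theorem miura_surjOn {s : ℝ} (hs : 0 ≤ s) :
    Set.SurjOn miura (SobolevZero s) (SobolevZero (s - 1)) := by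
  intro u hu
  rw [mem_sobolevZero_iff] at hu
  let b : ℤ → ℂ := fun k => fourierCoeff u k / (Complex.I * k)
  have hub (k : ℤ) : fourierCoeff u k = Complex.I * k * b k := by
    by_cases hk : k = 0
    · simp [hk, hu.2]
    · have : Complex.I * (k : ℂ) ≠ 0 := mul_ne_zero Complex.I_ne_zero (by exact_mod_cast hk)
      rw [mul_div_cancel₀ _ this]
  have hb0 : b 0 = 0 := by simp [b]
  have hbs : weightedNorm s b ≠ ∞ :=
    ne_top_of_le_ne_top (ENNReal.mul_ne_top ENNReal.ofNat_ne_top hu.1)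
      (weightedNorm_le_deriv s hub hb0)
  have hb : weightedNorm 0 b ≠ ∞ := ne_top_of_le_ne_top hbs (weightedNorm_mono hs _)
  let β : RealSeq := ⟨⟨b, memℓp_two_of_weightedNorm_ne_top hb⟩, hb0, fun k => by
    change b (-k) = starRingEnd ℂ (b k)
    simp [b, fourierCoeff_neg]⟩
  obtain ⟨a, ha⟩ := realSeq_quadratic_surjective β
  have ha : quadMap a = β := ha
  obtain ⟨v, -, hva, -⟩ := exists_distribution_of_realSeq a
  -- The solution was found only in L²; comparing it with 0 at order s places it in H^s.
  obtain ⟨L, hL, hLip⟩ := lipschitzInverse_self hs (weightedNorm s b) hbs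
  refine ⟨v, mem_sobolevZero_iff.2 ⟨?_, ?_⟩, ?_⟩
  · have h := hLip a 0 (by rw [ha]) (by rw [quadMap_zero]; simp [weightedNorm, l2Norm])
    rw [quadMap_zero, sub_zero, sub_zero, ha] at h
    rw [hva]
    exact ne_top_of_le_ne_top (ENNReal.mul_ne_top hL hbs) h
  · rw [hva]; exact a.2.1
  · refine Distribution.ext_fourierCoeff (funext fun k => ?_)
    rw [fourierCoeff_miura hva, ha, hub]

theorem fourierCoeff_sub_eq (u v : Distribution) :
    fourierCoeff (u - v) = fun k => fourierCoeff u k - fourierCoeff v k :=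
  funext (fourierCoeff_sub u v)

theorem weightedNorm_fourierCoeff_sub_ne_top {s : ℝ} {u v : Distribution}
    (hu : u ∈ SobolevZero s) (hv : v ∈ SobolevZero s) :
    weightedNorm s (fourierCoeff (u - v)) ≠ ∞ := by
  rw [fourierCoeff_sub_eq]
  exact ne_top_of_le_ne_top
    (ENNReal.add_ne_top.2 ⟨(mem_sobolevZero_iff.1 hu).1, (mem_sobolevZero_iff.1 hv).1⟩)
    (weightedNorm_sub_le _ _ _)

theorem sobolevNorm_sub_le_of_miura {s : ℝ} (hs : 0 ≤ s) {u₀ : Distribution}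
    (hu₀ : u₀ ∈ SobolevZero (s - 1)) (R : ℝ) :
    ∃ L : ℝ, ∀ v ∈ SobolevZero s, ∀ w ∈ SobolevZero s,
      sobolevNorm (s - 1) (miura v - u₀) ≤ R → sobolevNorm (s - 1) (miura w - u₀) ≤ R →
        sobolevNorm s (v - w) ≤ L * sobolevNorm (s - 1) (miura v - miura w) := by
  set N := weightedNorm (s - 1) (fourierCoeff u₀)
  have hN : N ≠ ∞ := (mem_sobolevZero_iff.1 hu₀).1
  have hπ : 1 ≤ √(2 * π) := one_le_sqrt.2 (by linarith [pi_gt_three])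
  -- The ball around `u₀` lies in the ball of radius R + N around 0; the factor 2 is the cost of
  -- ∂⁻¹, and √(2π) ≥ 1 lets the normalization be dropped.
  obtain ⟨L, hL, hLip⟩ := lipschitzInverse_self hs (2 * (ENNReal.ofReal R + N)) (by finiteness)
  have hball {v : Distribution} {a : RealSeq} (hv : v ∈ SobolevZero s) (ha : fourierCoeff v = a.1)
      (h : sobolevNorm (s - 1) (miura v - u₀) ≤ R) :
      weightedNorm s (quadMap a).1 ≤ 2 * (ENNReal.ofReal R + N) := by
    refine (weightedNorm_le_deriv s (fourierCoeff_miura ha) (quadMap a).2.1).trans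
      (mul_le_mul_right ?_ _)
    have hfin := weightedNorm_fourierCoeff_sub_ne_top (miura_mapsTo hs hv) hu₀
    have h1 : fourierCoeff (miura v) =
        fun k => fourierCoeff (miura v - u₀) k + fourierCoeff u₀ k := by
      ext k; rw [fourierCoeff_sub]; ring
    rw [h1]
    refine (weightedNorm_add_le _ _ _).trans (add_le_add_left ?_ _)
    rw [sobolevNorm_eq hfin] at h
    refine (ENNReal.le_ofReal_iff_toReal_le hfin ?_).2 ?_
    · exact (by positivity : 0 ≤ √(2 * π) * _).trans h
    · exact (le_mul_of_one_le_left ENNReal.toReal_nonneg hπ).trans h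
  refine ⟨(L * 2).toReal, fun v hv w hw hvR hwR => ?_⟩
  obtain ⟨a, ha⟩ := exists_realSeq_eq_fourierCoeff hs hv
  obtain ⟨b, hb⟩ := exists_realSeq_eq_fourierCoeff hs hw
  have h1 := hLip a b (hball hv ha hvR) (hball hw hb hwR)
  have hd (k : ℤ) : fourierCoeff (miura v - miura w) k =
      Complex.I * k * (quadMap a - quadMap b).1 k := by
    rw [fourierCoeff_sub, fourierCoeff_miura ha, fourierCoeff_miura hb, ← mul_sub]
    rfl
  have h2 := weightedNorm_le_deriv s hd (quadMap a - quadMap b).2.1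
  have hfin' := weightedNorm_fourierCoeff_sub_ne_top (miura_mapsTo hs hv) (miura_mapsTo hs hw)
  have h3 : weightedNorm s (fourierCoeff (v - w)) ≤
      L * 2 * weightedNorm (s - 1) (fourierCoeff (miura v - miura w)) := by
    rw [fourierCoeff_sub_eq, ha, hb, mul_assoc]
    exact h1.trans (mul_le_mul_right h2 _)
  rw [sobolevNorm_eq (weightedNorm_fourierCoeff_sub_ne_top hv hw), sobolevNorm_eq hfin']
  have h4 := ENNReal.toReal_mono
    (ENNReal.mul_ne_top (ENNReal.mul_ne_top hL ENNReal.ofNat_ne_top) hfin') h3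
  rw [ENNReal.toReal_mul] at h4
  calc _ ≤ √(2 * π) * ((L * 2).toReal * _) := mul_le_mul_of_nonneg_left h4 (by positivity)
    _ = _ := by ring

end Main
end Miura

theorem mainTheorem5 (s : ℝ) (hs : 1 / 2 ≤ s) :
    Set.BijOn Miura.miura (Miura.SobolevZero s) (Miura.SobolevZero (s - 1)) ∧
    ∀ u₀ ∈ Miura.SobolevZero (s - 1), ∀ R : ℝ, ∃ L : ℝ,
      ∀ u₁ ∈ Miura.SobolevZero (s - 1), ∀ u₂ ∈ Miura.SobolevZero (s - 1),
        Miura.sobolevNorm (s - 1) (u₁ - u₀) ≤ R → Miura.sobolevNorm (s - 1) (u₂ - u₀) ≤ R →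
          Miura.sobolevNorm s
              (Function.invFunOn Miura.miura (Miura.SobolevZero s) u₁ -
                Function.invFunOn Miura.miura (Miura.SobolevZero s) u₂) ≤
            L * Miura.sobolevNorm (s - 1) (u₁ - u₂) := by
  have hs0 : 0 ≤ s := by linarith
  refine ⟨⟨Miura.miura_mapsTo hs0, Miura.miura_injOn hs0, Miura.miura_surjOn hs0⟩,
    fun u₀ hu₀ R => ?_⟩
  obtain ⟨L, hL⟩ := Miura.sobolevNorm_sub_le_of_miura hs0 hu₀ R
  refine ⟨L, fun u₁ hu₁ u₂ hu₂ h₁ h₂ => ?_⟩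
  have e₁ := Function.invFunOn_eq (Miura.miura_surjOn hs0 hu₁)
  have e₂ := Function.invFunOn_eq (Miura.miura_surjOn hs0 hu₂)
  have h := hL _ (Function.invFunOn_mem (Miura.miura_surjOn hs0 hu₁)) _
    (Function.invFunOn_mem (Miura.miura_surjOn hs0 hu₂))
  rw [e₁, e₂] at h
  exact h h₁ h₂
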